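/- Let $m,n\ge 0$ be integers with $n$ even and $N=m+n>2$; put $s=\lfloor N/2\rfloor$ and $i'=N+1-i$. Let $V=\mathbb{C}^{m|n}$ have a homogeneous basis $v_1,\dots,v_N$ with parities $\bar i=|v_i|\in\mathbb{Z}/2$, such that exactly $m$ of the $v_i$ are even, exactly $n$ are odd, and $\overline{i'}=\bar i$ for all $i$ (any parity sequence with these properties is allowed). Let $\vartheta_1,\dots,\vartheta_N\in\{\pm1\}$ satisfy $\vartheta_i=1$ if $\bar i=\bar0$ and $\vartheta_i=-\vartheta_{i'}$ if $\bar i=\bar1$. With elementary matrices $E_{ij}$ put $$X_{ij}=E_{ij}-(-1)^{\bar i(\bar i+\bar j)}\vartheta_i\vartheta_jE_{j'i'} .$$ Let $P=\bigoplus_{i=1}^s\mathbb{Z}\varepsilon_i$ with the form $(\varepsilon_i,\varepsilon_j)=\delta_{ij}(-1)^{\bar i}$, and put $\varepsilon_{i'}=-\varepsilon_i$ for $i\le s$ and $\varepsilon_{s+1}=0$ if $N$ is odd. **Chevalley generators.** For $1\le i\le s$ put $$\alpha_i=\varepsilon_i-\varepsilon_{i+1},\quad \mathsf e_i=X_{i,i+1},\quad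 \mathsf f_i=(-1)^{\bar i}X_{i+1,i},\quad \mathsf h_i=(-1)^{\bar i}X_{ii}-(-1)^{\overline{i+1}}X_{i+1,i+1},$$ except for $i=s$ and $m$ even, where - if $\bar s=\bar0$: $\alpha_s=\varepsilon_{s-1}+\varepsilon_s$, $\mathsf e_s=X_{s-1,s+1}$, $\mathsf f_s=(-1)^{\overline{s-1}}X_{s+1,s-1}$, $\mathsf h_s=(-1)^{\overline{s-1}}X_{s-1,s-1}-(-1)^{\overline{s+1}}X_{s+1,s+1}$; - if $\bar s=\bar1$: $\alpha_s=2\varepsilon_s$, $\mathsf e_s=E_{s,s+1}$, $\mathsf f_s=-2E_{s+1,s}$, $\mathsf h_s=-2X_{ss}$. Put $a_{ij}=(\alpha_i,\alpha_j)$, and let $|\alpha_i|\in\mathbb{Z}/2$ be the parity of the matrix $\mathsf e_i$ (where $|E_{ab}|=\bar a+\bar b$). **The quantum supergroup.** $U_q(\mathfrak{osp}(V))$ is the superalgebra over $\mathbb{C}(q^{1/2})$ generated by $e_i,f_i$ (of parity $|\alpha_i|$) and $q^{\pm h_i/2}$ (even), $1\le i\le s$, with the relations $$q^{h_i/2}q^{h_j/2}=q^{h_j/2}q^{h_i/2},\quad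 q^{\pm h_i/2}q^{\mp h_i/2}=1,\quad q^{h_i/2}e_jq^{-h_i/2}=q^{a_{ij}/2}e_j,\quad q^{h_i/2}f_jq^{-h_i/2}=q^{-a_{ij}/2}f_j,$$ $$e_if_j-(-1)^{|\alpha_i||\alpha_j|}f_je_i=\delta_{ij}\frac{q^{h_i}-q^{-h_i}}{q-q^{-1}},$$ and the $q$-Serre relations below, both for $x_i=e_i$ (with $\deg x_i=\alpha_i$) and for $x_i=f_i$ (with $\deg x_i=-\alpha_i$). Here $[\![a,b]\!]=ab-(-1)^{|a||b|}q^{(\deg a,\deg b)}ba$ for homogeneous $a,b$. 1. $[\![x_i,x_j]\!]=0$ if $i\ne j$ and $a_{ij}=0$. 2. $x_i^2=0$ if $a_{ii}=0$. 3. $[\![x_i,[\![x_i,\dots,[\![x_i,x_j]\!]\dots]\!]]\!]=0$ with $1-2a_{ij}/a_{ii}$ factors $x_i$, if $i\neq j$, $a_{ii}\neq0$ and $a_{ij}\ne0$. 4. $[\![[\![[\![x_i,x_j]\!],x_k]\!],x_j]\!]=0$ if $i<j<k$, $a_{jj}=0$, $a_{ik}=0$ and $a_{ij}=-a_{jk}\ne0$.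 5. If $m$ is even, $s\ge3$ and $(\overline{s-2},\overline{s-1},\bar s)=(\bar1,\bar0,\bar1)$: $[\![[\![u,[\![u,x_s]\!]]\!],x_{s-1}]\!]=0$, where $u=[\![x_{s-2},x_{s-1}]\!]$. 6. If $m$ is even, $s\ge4$ and $(\overline{s-2},\overline{s-1},\bar s)=(\bar0,\bar0,\bar1)$: $[\![[\![[\![[\![[\![[\![x_{s-3},x_{s-2}]\!],x_{s-1}]\!],x_s]\!],x_{s-1}]\!],x_{s-2}]\!],x_{s-1}]\!]=0$. 7. If $m$ is even, $s\ge3$ and $(\overline{s-1},\bar s)=(\bar1,\bar0)$: $[\![x_s,[\![x_{s-1},x_{s-2}]\!]]\!]=[\![x_{s-1},[\![x_s,x_{s-2}]\!]]\!]$. **Proposition.** Identify $\mathrm{End}(V)$ (after extension of scalars to $\mathbb{C}(q^{1/2})$) with the $N\times N$ matrices, and for a diagonal matrix $D=\mathrm{diag}(d_1,\dots,d_N)$ put $q^D=\mathrm{diag}(q^{d_1},\dots,q^{d_N})$. Then there is a unique representation $\varrho\colon U_q(\mathfrak{osp}(V))\to\mathrm{End}(V)$, that is, a unique homomorphism of algebras,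 such that $$\varrho(e_i)=\mathsf e_i,\qquad \varrho(f_i)=\kappa_i\mathsf f_i,\qquad \varrho(q^{\pm h_i/2})=q^{\pm\mathsf h_i/2}\qquad(1\le i\le s),$$ where $\kappa_s=\frac{q+q^{-1}}2$ if $m$ is even and $\bar s=\bar1$, and $\kappa_i=1$ in all other cases. Moreover, $\varrho$ is compatible with the $\mathbb{Z}/2$-gradings, i.e. it is a homomorphism of superalgebras. -/

import Mathlib

noncomputable section

namespace QuantumOsp

open Matrix

/-- The ground field `ℂ(q^{1/2})`, realised as the field of rational functions over `ℂ` in the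
variable `q^{1/2}`. -/
abbrev K : Type := RatFunc ℂ

/-- The element `q^{1/2}` of the ground field. -/
def qHalf : K := RatFunc.X

/-- The element `q` of the ground field. -/
def q : K := qHalf ^ 2

/-- The sign `(-1)^a` attached to `a ∈ ℤ/2`. -/
def sgn (a : ZMod 2) : ℤ := (-1) ^ a.val

/-- A choice of parities of the basis vectors `v_1, …, v_N` of `V = ℂ^{m|n}`, `N = m + n`,
symmetric under `i ↦ i' = N + 1 - i`, together with a compatible sequence of signs `ϑ_i`.
Throughout, the indices `1, …, N` are represented by `Fin (m + n)`, hence shifted by one, and the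
involution `i ↦ i'` becomes `Fin.rev`. -/
structure ParityData (m n : ℕ) where
  /-- the parity of the basis vector `v_i` -/
  parity : Fin (m + n) → ZMod 2
  parity_rev : ∀ i, parity i.rev = parity i
  card_even : (Finset.univ.filter fun i => parity i = 0).card = m
  card_odd : (Finset.univ.filter fun i => parity i = 1).card = n
  /-- the sign `ϑ_i` -/
  theta : Fin (m + n) → ℤˣ
  theta_even : ∀ i, parity i = 0 → theta i = 1
  theta_odd : ∀ i, parity i = 1 → theta i = -theta i.rev

/-- The rank `s = ⌊N / 2⌋`. Simple roots are indexed by `Fin s`, again shifted by one. -/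
abbrev rk (m n : ℕ) : ℕ := (m + n) / 2

variable {m n : ℕ}

/-- The basis index `i`, for `1 ≤ i ≤ s`. -/
def lo (i : Fin (rk m n)) : Fin (m + n) := ⟨i, by have := i.2; unfold rk at this; omega⟩

/-- The basis index `i + 1`, for `1 ≤ i ≤ s`. -/
def nx (i : Fin (rk m n)) : Fin (m + n) := ⟨i + 1, by have := i.2; unfold rk at this; omega⟩

/-- The basis index `i - 1`, for `2 ≤ i ≤ s`. -/
def pv (i : Fin (rk m n)) : Fin (m + n) := ⟨i - 1, by have := i.2; unfold rk at this; omega⟩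

namespace ParityData

variable (D : ParityData m n)

/-! ### The Lie superalgebra side -/

/-- `X_{ij} = E_{ij} - (-1)^{|i|(|i|+|j|)} ϑ_i ϑ_j E_{j'i'}`. -/
def X (i j : Fin (m + n)) : Matrix (Fin (m + n)) (Fin (m + n)) ℤ :=
  single i j 1 -
    single j.rev i.rev
      (sgn (D.parity i * (D.parity i + D.parity j)) * (D.theta i : ℤ) * (D.theta j : ℤ))

/-- `i = s`, `m` is even and `v_s` is even: the simple root is `ε_{s-1} + ε_s`. -/
def IsFork (i : Fin (rk m n)) : Prop := Even m ∧ (i : ℕ) + 1 = rk m n ∧ D.parity (lo i) = 0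

/-- `i = s`, `m` is even and `v_s` is odd: the simple root is `2 ε_s`. -/
def IsLong (i : Fin (rk m n)) : Prop := Even m ∧ (i : ℕ) + 1 = rk m n ∧ D.parity (lo i) = 1

open Classical in
/-- The basis index `r` such that (apart from the case of `2 ε_s`) the simple root vectors are
`𝖾_i = X_{r,i+1}` and `𝖿_i = ± X_{i+1,r}`: it is `s - 1` if `α_i = ε_{s-1} + ε_s`, and `i`
otherwise. -/
def row (i : Fin (rk m n)) : Fin (m + n) := if D.IsFork i then pv i else lo i

open Classical in
/-- The Chevalley generator `𝖾_i`. -/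
def chevE (i : Fin (rk m n)) : Matrix (Fin (m + n)) (Fin (m + n)) ℤ :=
  if D.IsLong i then single (lo i) (nx i) 1 else D.X (D.row i) (nx i)

open Classical in
/-- The Chevalley generator `𝖿_i`. -/
def chevF (i : Fin (rk m n)) : Matrix (Fin (m + n)) (Fin (m + n)) ℤ :=
  if D.IsLong i then single (nx i) (lo i) (-2)
  else sgn (D.parity (D.row i)) • D.X (nx i) (D.row i)

open Classical in
/-- The Chevalley generator `𝗁_i`, a diagonal matrix. -/
def chevH (i : Fin (rk m n)) : Matrix (Fin (m + n)) (Fin (m + n)) ℤ :=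
  if D.IsLong i then (-2 : ℤ) • D.X (lo i) (lo i)
  else sgn (D.parity (D.row i)) • D.X (D.row i) (D.row i) -
    sgn (D.parity (nx i)) • D.X (nx i) (nx i)

end ParityData

/-- The weight lattice `P = ⊕_{i=1}^s ℤ ε_i`. -/
abbrev Wt (m n : ℕ) : Type := Fin (rk m n) → ℤ

/-- The weight `ε_r`, `1 ≤ r ≤ N`, in terms of the basis `ε_1, …, ε_s`: one has `ε_{r'} = -ε_r`,
and `ε_{s+1} = 0` if `N` is odd. -/
def eps (r : Fin (m + n)) : Wt m n := fun k =>
  if lo k = r then 1 else if (lo k).rev = r then -1 else 0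

namespace ParityData

variable (D : ParityData m n)

/-- The bilinear form on weights, `(ε_i, ε_j) = δ_{ij} (-1)^{|i|}`. -/
def form (x y : Wt m n) : ℤ := ∑ k, sgn (D.parity (lo k)) * x k * y k

open Classical in
/-- The simple root `α_i`. -/
def simpleRoot (i : Fin (rk m n)) : Wt m n :=
  if D.IsLong i then (2 : ℤ) • eps (lo i) else eps (D.row i) - eps (nx i)

/-- The symmetrized Cartan matrix `a_{ij} = (α_i, α_j)`. -/
def cartan (i j : Fin (rk m n)) : ℤ := D.form (D.simpleRoot i) (D.simpleRoot j)

/-- The parity of the simple root `α_i`, that is the parity of `𝖾_i` and of `𝖿_i`. -/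
def rootParity (i : Fin (rk m n)) : ZMod 2 := D.parity (D.row i) + D.parity (nx i)

end ParityData

/-! ### The quantum supergroup -/

/-- The generators `e_i, f_i, q^{h_i/2}, q^{-h_i/2}`. -/
inductive Gen (m n : ℕ) : Type
  | e (i : Fin (rk m n))
  | f (i : Fin (rk m n))
  | k (i : Fin (rk m n))
  | kInv (i : Fin (rk m n))

/-- The free algebra on the generators. -/
abbrev Free (m n : ℕ) : Type := FreeAlgebra K (Gen m n)

/-- A generator as an element of the free algebra. -/
abbrev gen (g : Gen m n) : Free m n := FreeAlgebra.ι K g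

namespace ParityData

variable (D : ParityData m n)

/-- The parity of a generator. -/
def genParity : Gen m n → ZMod 2
  | .e i => D.rootParity i
  | .f i => D.rootParity i
  | .k _ => 0
  | .kInv _ => 0

end ParityData

/-- An element of the free algebra that is homogeneous for the `ℤ/2`-grading and for the grading by
weights, recorded with its two degrees. Only the generators and their iterated `q`-superbrackets
are used below. -/
structure HomElt (m n : ℕ) where
  val : Free m n
  par : ZMod 2
  deg : Wt m n

namespace ParityData

variable (D : ParityData m n)

/-- The generator `e_i`, of weight `α_i`. -/
def eElt (i : Fin (rk m n)) : HomElt m n := ⟨gen (.e i), D.rootParity i, D.simpleRoot i⟩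

/-- The generator `f_i`, of weight `-α_i`. -/
def fElt (i : Fin (rk m n)) : HomElt m n := ⟨gen (.f i), D.rootParity i, -D.simpleRoot i⟩

/-- The `q`-superbracket `⟦a, b⟧ = a b - (-1)^{|a||b|} q^{(deg a, deg b)} b a`. -/
def br (a b : HomElt m n) : HomElt m n where
  val := a.val * b.val - ((sgn (a.par * b.par) : K) * q ^ D.form a.deg b.deg) • (b.val * a.val)
  par := a.par + b.par
  deg := a.deg + b.deg

/-- The left-hand sides of the standard and of the higher order `q`-Serre relations, for a family
`x` of homogeneous elements, which is either `(e_i)` or `(f_i)`. -/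
inductive SerreElt (x : Fin (rk m n) → HomElt m n) : Free m n → Prop
  /-- `⟦x_i, x_j⟧` for orthogonal simple roots -/
  | orthogonal (i j : Fin (rk m n)) (hij : i ≠ j) (h : D.cartan i j = 0) :
      SerreElt x (D.br (x i) (x j)).val
  /-- `x_i ^ 2` for an isotropic simple root -/
  | isotropic (i : Fin (rk m n)) (h : D.cartan i i = 0) :
      SerreElt x ((x i).val ^ 2)
  /-- `⟦x_i, ⟦x_i, …, ⟦x_i, x_j⟧…⟧⟧` with `1 - 2 a_{ij} / a_{ii}` factors `x_i`, for a
  non-isotropic `α_i` -/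
  | standard (i j : Fin (rk m n)) (hij : i ≠ j) (hi : D.cartan i i ≠ 0) (h : D.cartan i j ≠ 0) :
      SerreElt x ((D.br (x i))^[(1 - 2 * D.cartan i j / D.cartan i i).toNat] (x j)).val
  /-- `⟦⟦⟦x_i, x_j⟧, x_k⟧, x_j⟧` for an isotropic `α_j` joining `α_i` and `α_k` (types A, B) -/
  | quartic (i j k : Fin (rk m n)) (hij : i < j) (hjk : j < k) (hj : D.cartan j j = 0)
      (hik : D.cartan i k = 0) (h0 : D.cartan i j ≠ 0) (h : D.cartan i j + D.cartan j k = 0) :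
      SerreElt x (D.br (D.br (D.br (x i) (x j)) (x k)) (x j)).val
  /-- `⟦⟦⟦x_{s-2}, x_{s-1}⟧, ⟦⟦x_{s-2}, x_{s-1}⟧, x_s⟧⟧, x_{s-1}⟧` for `m` even and parities
  `(…, 1, 0, 1)` (type C) -/
  | sextic (i j k : Fin (rk m n)) (hij : (i : ℕ) + 1 = j) (hjk : (j : ℕ) + 1 = k)
      (hk : (k : ℕ) + 1 = rk m n) (hm : Even m) (pi : D.parity (lo i) = 1)
      (pj : D.parity (lo j) = 0) (pk : D.parity (lo k) = 1) :
      SerreElt x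
        (D.br (D.br (D.br (x i) (x j)) (D.br (D.br (x i) (x j)) (x k))) (x j)).val
  /-- `⟦⟦⟦⟦⟦⟦x_{s-3}, x_{s-2}⟧, x_{s-1}⟧, x_s⟧, x_{s-1}⟧, x_{s-2}⟧, x_{s-1}⟧` for `m` even and
  parities `(…, 0, 0, 1)` (type C) -/
  | septic (l i j k : Fin (rk m n)) (hli : (l : ℕ) + 1 = i) (hij : (i : ℕ) + 1 = j)
      (hjk : (j : ℕ) + 1 = k) (hk : (k : ℕ) + 1 = rk m n) (hm : Even m)
      (pi : D.parity (lo i) = 0) (pj : D.parity (lo j) = 0) (pk : D.parity (lo k) = 1) :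
      SerreElt x
        (D.br (D.br (D.br (D.br (D.br (D.br (x l) (x i)) (x j)) (x k)) (x j)) (x i)) (x j)).val
  /-- `⟦x_s, ⟦x_{s-1}, x_{s-2}⟧⟧ - ⟦x_{s-1}, ⟦x_s, x_{s-2}⟧⟧` for `m` even and parities
  `(…, 1, 0)` (type D) -/
  | cubic (i j k : Fin (rk m n)) (hij : (i : ℕ) + 1 = j) (hjk : (j : ℕ) + 1 = k)
      (hk : (k : ℕ) + 1 = rk m n) (hm : Even m)
      (pj : D.parity (lo j) = 1) (pk : D.parity (lo k) = 0) :
      SerreElt x ((D.br (x k) (D.br (x j) (x i))).val - (D.br (x j) (D.br (x k) (x i))).val)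

/-- The defining relations of `U_q(osp(V))`. -/
inductive Rel : Free m n → Free m n → Prop
  | k_comm (i j : Fin (rk m n)) : Rel (gen (.k i) * gen (.k j)) (gen (.k j) * gen (.k i))
  | k_kInv (i : Fin (rk m n)) : Rel (gen (.k i) * gen (.kInv i)) 1
  | kInv_k (i : Fin (rk m n)) : Rel (gen (.kInv i) * gen (.k i)) 1
  | k_e (i j : Fin (rk m n)) :
      Rel (gen (.k i) * gen (.e j) * gen (.kInv i)) (qHalf ^ D.cartan i j • gen (.e j))
  | k_f (i j : Fin (rk m n)) :
      Rel (gen (.k i) * gen (.f j) * gen (.kInv i)) (qHalf ^ (-D.cartan i j) • gen (.f j))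
  | e_f (i j : Fin (rk m n)) :
      Rel (gen (.e i) * gen (.f j) -
          (sgn (D.rootParity i * D.rootParity j) : K) • (gen (.f j) * gen (.e i)))
        (if i = j then (q - q⁻¹)⁻¹ • (gen (.k i) ^ 2 - gen (.kInv i) ^ 2) else 0)
  | serre_e (z : Free m n) (hz : D.SerreElt D.eElt z) : Rel z 0
  | serre_f (z : Free m n) (hz : D.SerreElt D.fElt z) : Rel z 0

/-- The orthosymplectic quantum supergroup `U_q(osp(V))`, as an algebra over `ℂ(q^{1/2})`. -/
abbrev Uq : Type := RingQuot D.Rel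

/-- The image of a generator in `U_q(osp(V))`. -/
def toUq (g : Gen m n) : D.Uq := RingQuot.mkAlgHom K D.Rel (gen g)

/-- The homogeneous component of `U_q(osp(V))` of parity `p`, spanned by the monomials of
parity `p` in the generators. -/
def UqGraded (p : ZMod 2) : Submodule K D.Uq :=
  Submodule.span K {x | ∃ l : List (Gen m n), (l.map D.genParity).sum = p ∧
    x = (l.map D.toUq).prod}

/-! ### The vector superspace and the operators on it -/

/-- The homogeneous component of parity `p` of `V` (over the ground field). -/
def VGraded (p : ZMod 2) : Submodule K (Fin (m + n) → K) :=
  Submodule.span K {v | ∃ i, D.parity i = p ∧ v = Pi.single i 1}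

end ParityData

/-- The operator on `V` with a given integral matrix in the basis `v_1, …, v_N`. -/
def matOp (A : Matrix (Fin (m + n)) (Fin (m + n)) ℤ) : Module.End K (Fin (m + n) → K) :=
  Matrix.toLin' (A.map fun z : ℤ => (z : K))

/-- The operator `q^{A/2}` on `V`, for a diagonal matrix `A` with integral entries. -/
def qPowHalf (A : Matrix (Fin (m + n)) (Fin (m + n)) ℤ) : Module.End K (Fin (m + n) → K) :=
  Matrix.toLin' (Matrix.diagonal fun r => qHalf ^ A r r)

open Classical in
/-- The scalar `κ_i`: it is `(q + q⁻¹) / 2` if `m` is even, `v_s` is odd and `i = s`, and `1`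
otherwise. -/
def ParityData.kappa (D : ParityData m n) (i : Fin (rk m n)) : K :=
  if D.IsLong i then (q + q⁻¹) / 2 else 1

end QuantumOsp

end

noncomputable section

namespace QuantumOsp

open Matrix

/-! Give v_r the weight ε_r, so that E_{tr} has weight ε_t - ε_r. Every ε_r has at most one nonzero
coordinate, and it is ±1; hence the coordinates of a weight occurring in End(V) have absolute values
of total at most 2. A homogeneous expression in the Chevalley generators whose weight exceeds this
bound vanishes on V, whatever powers of q occur in it (`IsGraded.eq_zero_of_large`).

This settles almost all relations: the mixed relations with i ≠ j and the q-Serre relations become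
inspections of coordinates of sums of simple roots (`large_sub`, `large_add`, `large_two_smul`,
`large_standard`, `large_quartic`, `large_sextic`, `large_septic`). The exceptions come from the
fork α_{s-1} = ε_{s-1} - ε_s, α_s = ε_{s-1} + ε_s, where 2ε_{s-1}, -2ε_s and ε_{s-2} + ε_{s-1} do
occur in End(V). There the matrices are multiplied out, and the relations follow from the symmetry
between v_s and v_{s'}, available because v_s is even (`X_mul_X_rev`, `commute_X_X_rev`,
`commute_X_rev_X`, `cubic_matrix`).

The Cartan relations hold because 𝗁_i acts on v_t by (α_i, ε_t) (`chevH_apply_self`). The relation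
between e_i and f_i reduces to the classical [𝖾_i, 𝖿_i] = 𝗁_i (`chevE_superbracket_chevF`): the
eigenvalues of 𝗁_i are 0, ±1, which equal their own q-numbers, except for α_s = 2ε_s, where they are
0, ±2 and κ_s corrects 2 to q + q⁻¹ (`kappa_mul_chevH`).

Uniqueness is determination by generators, and compatibility with parity is the same grading
argument with parities in place of weights. -/

/-- A matrix is homogeneous of degree `g` for the weights `w` of the basis vectors. -/
def IsGraded {ι R G : Type*} [Zero R] [Sub G] (w : ι → G) (A : Matrix ι ι R) (g : G) : Prop :=
  ∀ t r, A t r ≠ 0 → w t - w r = g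

/-! ### Calculus of homogeneous matrices -/

namespace IsGraded

variable {ι R G : Type*} [AddCommGroup G] {w : ι → G} {g h : G}

theorem mul [Fintype ι] [CommRing R] {A B : Matrix ι ι R} (hA : IsGraded w A g)
    (hB : IsGraded w B h) : IsGraded w (A * B) (g + h) := by
  intro t r hne
  obtain ⟨u, -, hu⟩ := Finset.exists_ne_zero_of_sum_ne_zero hne
  rw [← hA t u (left_ne_zero_of_mul hu), ← hB u r (right_ne_zero_of_mul hu)]
  abel

theorem sub [CommRing R] {A B : Matrix ι ι R} (hA : IsGraded w A g)
    (hB : IsGraded w B g) : IsGraded w (A - B) g := by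
  intro t r hne
  by_cases h : A t r = 0
  · exact hB t r fun h' => hne (by simp [h, h'])
  · exact hA t r h

theorem smul [CommRing R] {A : Matrix ι ι R} (hA : IsGraded w A g) (c : R) :
    IsGraded w (c • A) g := fun t r hne =>
  hA t r fun h => hne (by simp [h])

theorem one [DecidableEq ι] [CommRing R] : IsGraded w (1 : Matrix ι ι R) 0 := by
  intro t r hne
  by_cases h : t = r
  · simp [h]
  · exact absurd (Matrix.one_apply_ne h) hne

theorem diagonal [DecidableEq ι] [CommRing R] (d : ι → R) :
    IsGraded w (Matrix.diagonal d) 0 := by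
  intro t r hne
  by_cases h : t = r
  · simp [h]
  · exact absurd (Matrix.diagonal_apply_ne d h) hne

theorem single [DecidableEq ι] [CommRing R] {a b : ι} (c : R) (h : w a - w b = g) :
    IsGraded w (Matrix.single a b c) g := by
  intro t r hne
  rw [Matrix.single_apply] at hne
  split_ifs at hne with hab
  · rw [← hab.1, ← hab.2, h]
  · exact absurd rfl hne

theorem map_intCast [CommRing R] {A : Matrix ι ι ℤ} (hA : IsGraded w A g) :
    IsGraded w (A.map fun z : ℤ => (z : R)) g := fun t r hne =>
  hA t r fun h => hne (by simp [h])

end IsGraded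

/-! ### Weights of V and the bound on their differences -/

variable {m n : ℕ}

theorem sgn_cases (a : ZMod 2) : sgn a = 1 ∧ a = 0 ∨ sgn a = -1 ∧ a = 1 := by
  revert a; decide

theorem sgn_mul_self (a : ZMod 2) : sgn a * sgn a = 1 := by
  revert a; decide

theorem zmod_two_cases (a : ZMod 2) : a = 0 ∨ a = 1 := by
  revert a; decide

theorem eps_rev (r : Fin (m + n)) : eps r.rev = -eps r := by
  funext k
  have hk := k.2
  have hr := r.2
  unfold rk at hk
  simp only [eps, lo, Pi.neg_apply, Fin.ext_iff, Fin.val_rev]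
  split_ifs <;> omega

/-- An index is `lo k` or its mirror image for at most one `k`. -/
theorem abs_eps_add_le (r : Fin (m + n)) {a b : Fin (rk m n)} (h : a ≠ b) :
    |eps r a| + |eps r b| ≤ 1 := by
  have ha := a.2
  have hb := b.2
  have hr := r.2
  unfold rk at ha hb
  simp only [eps, lo, Fin.ext_iff, Fin.val_rev, ne_eq] at *
  split_ifs <;> first | omega | simp

theorem abs_eps_add_add_le (r : Fin (m + n)) {a b c : Fin (rk m n)} (hab : a ≠ b) (hac : a ≠ c)
    (hbc : b ≠ c) : |eps r a| + |eps r b| + |eps r c| ≤ 1 := by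
  have h1 := abs_eps_add_le r hab
  have h2 := abs_eps_add_le r hac
  have h3 := abs_eps_add_le r hbc
  have h4 := abs_nonneg (eps r a)
  have h5 := abs_nonneg (eps r b)
  have h6 := abs_nonneg (eps r c)
  -- Adding the three bounds gives twice the sum at most 3, hence the sum at most 1 by integrality.
  omega

/-- A weight is large if two or three of its coordinates have absolute values adding up to at
least `3`; such a weight is not a difference of two weights of `V`. -/
def Large (β : Wt m n) : Prop :=
  (∃ a b, a ≠ b ∧ 3 ≤ |β a| + |β b|) ∨
    ∃ a b c, a ≠ b ∧ a ≠ c ∧ b ≠ c ∧ 3 ≤ |β a| + |β b| + |β c|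

theorem Large.neg {β : Wt m n} (h : Large β) : Large (-β) := by
  simpa [Large] using h

theorem not_large_eps_sub_eps (t r : Fin (m + n)) : ¬ Large (eps t - eps r) := by
  rintro (⟨a, b, hab, h⟩ | ⟨a, b, c, hab, hac, hbc, h⟩)
  · have h1 := abs_eps_add_le t hab
    have h2 := abs_eps_add_le r hab
    have h3 := abs_sub (eps t a) (eps r a)
    have h4 := abs_sub (eps t b) (eps r b)
    simp only [Pi.sub_apply] at h
    omega
  · have h1 := abs_eps_add_add_le t hab hac hbc
    have h2 := abs_eps_add_add_le r hab hac hbc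
    have h3 := abs_sub (eps t a) (eps r a)
    have h4 := abs_sub (eps t b) (eps r b)
    have h5 := abs_sub (eps t c) (eps r c)
    simp only [Pi.sub_apply] at h
    omega

theorem IsGraded.eq_zero_of_large {A : Matrix (Fin (m + n)) (Fin (m + n)) K} {β : Wt m n}
    (hA : IsGraded eps A β) (hβ : Large β) : A = 0 := by
  ext t r
  by_contra hne
  exact not_large_eps_sub_eps t r (hA t r hne ▸ hβ)

/-! ### Simple roots in coordinates -/

namespace ParityData

variable (D : ParityData m n)

theorem IsLong.not_isFork {D : ParityData m n} {i : Fin (rk m n)} (h : D.IsLong i) :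
    ¬ D.IsFork i := fun h' => by
  have := h.2.2.symm.trans h'.2.2
  exact absurd this (by decide)

theorem row_of_isFork {D : ParityData m n} {i : Fin (rk m n)} (h : D.IsFork i) :
    D.row i = pv i := if_pos h

theorem row_of_not_isFork {D : ParityData m n} {i : Fin (rk m n)} (h : ¬ D.IsFork i) :
    D.row i = lo i := if_neg h

theorem nx_eq_rev (hn : Even n) (hm : Even m) {i : Fin (rk m n)} (hi : (i : ℕ) + 1 = rk m n) :
    nx i = (lo i).rev := by
  obtain ⟨a, ha⟩ := hn
  obtain ⟨b, hb⟩ := hm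
  unfold rk at hi
  simp only [nx, lo, Fin.ext_iff, Fin.val_rev]
  omega

theorem IsLong.nx_eq {D : ParityData m n} (hn : Even n) {i : Fin (rk m n)} (h : D.IsLong i) :
    nx i = (lo i).rev := nx_eq_rev hn h.1 h.2.1

theorem IsFork.nx_eq {D : ParityData m n} (hn : Even n) {i : Fin (rk m n)} (h : D.IsFork i) :
    nx i = (lo i).rev := nx_eq_rev hn h.1 h.2.1

/-- A simple root that is neither `2 ε_s` nor `ε_{s-1} + ε_s` is the last one only if `N` is
odd. -/
theorem last_odd {D : ParityData m n} (hn : Even n) {i : Fin (rk m n)} (hL : ¬ D.IsLong i)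
    (hF : ¬ D.IsFork i) (hi : (i : ℕ) + 1 = rk m n) : (m + n) % 2 = 1 := by
  by_contra hodd
  have hm : Even m := by
    obtain ⟨a, ha⟩ := hn
    rw [Nat.even_iff]; omega
  rcases zmod_two_cases (D.parity (lo i)) with h | h
  · exact hF ⟨hm, hi, h⟩
  · exact hL ⟨hm, hi, h⟩

open Classical in
/-- The coordinates of the simple roots. -/
theorem simpleRoot_apply (hn : Even n) (hN : 2 < m + n) (i k : Fin (rk m n)) :
    D.simpleRoot i k =
      if D.IsLong i then (if (k : ℕ) = i then 2 else 0)
      else if D.IsFork i then (if (k : ℕ) = i ∨ (k : ℕ) + 1 = i then 1 else 0)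
      else (if (k : ℕ) = i then 1 else if (k : ℕ) = i + 1 then -1 else 0) := by
  have hi := i.2
  have hk := k.2
  unfold rk at hi hk
  by_cases hL : D.IsLong i
  · simp only [simpleRoot, hL, if_true, Pi.smul_apply, eps, lo, Fin.ext_iff, Fin.val_rev,
      smul_eq_mul]
    split_ifs <;> omega
  · by_cases hF : D.IsFork i
    · have h1 := hF.2.1
      obtain ⟨a, ha⟩ := hn
      obtain ⟨b, hb⟩ := hF.1
      simp only [simpleRoot, hL, hF, if_false, if_true, row_of_isFork hF, hF.nx_eq ⟨a, ha⟩, eps_rev,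
        Pi.sub_apply, Pi.neg_apply]
      unfold rk at h1
      simp only [eps, lo, pv, Fin.ext_iff, Fin.val_rev]
      split_ifs <;> omega
    · simp only [simpleRoot, hL, hF, if_false, row_of_not_isFork hF, Pi.sub_apply]
      -- If `i` is the last root here, `nx i` is the middle index of weight 0, in agreement with no
      -- `k` being equal to `i + 1`.
      have h1 := last_odd hn hL hF
      unfold rk at h1
      simp only [eps, lo, nx, Fin.ext_iff, Fin.val_rev]
      split_ifs <;> omega

end ParityData

/-! ### The bilinear form and the Cartan integers -/

namespace ParityData

variable (D : ParityData m n)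

theorem form_comm (x y : Wt m n) : D.form x y = D.form y x := by
  unfold form
  exact Finset.sum_congr rfl fun k _ => by ring

theorem form_add_left (x y z : Wt m n) : D.form (x + y) z = D.form x z + D.form y z := by
  simp [form, mul_add, add_mul, Finset.sum_add_distrib]

theorem form_neg_left (x z : Wt m n) : D.form (-x) z = -D.form x z := by
  simp [form]

theorem form_neg_right (x z : Wt m n) : D.form x (-z) = -D.form x z := by
  simp [form]

theorem form_sub_left (x y z : Wt m n) : D.form (x - y) z = D.form x z - D.form y z := by
  rw [sub_eq_add_neg, form_add_left, form_neg_left, sub_eq_add_neg]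

theorem form_sub_right (x y z : Wt m n) : D.form x (y - z) = D.form x y - D.form x z := by
  rw [form_comm, form_sub_left, form_comm, D.form_comm z]

theorem form_add_right (x y z : Wt m n) : D.form x (y + z) = D.form x y + D.form x z := by
  rw [form_comm, form_add_left, form_comm, D.form_comm z]

theorem form_smul_left (c : ℤ) (x z : Wt m n) : D.form (c • x) z = c * D.form x z := by
  simp only [form, Finset.mul_sum, Pi.smul_apply, smul_eq_mul]
  exact Finset.sum_congr rfl fun k _ => by ring

theorem form_smul_right (c : ℤ) (x z : Wt m n) : D.form x (c • z) = c * D.form x z := by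
  rw [form_comm, form_smul_left, form_comm]

theorem eps_lo (i : Fin (rk m n)) : (eps (lo i) : Wt m n) = Pi.single i 1 := by
  funext k
  have hi := i.2
  have hk := k.2
  unfold rk at hi hk
  simp only [eps, lo, Fin.ext_iff, Fin.val_rev, Pi.single_apply]
  split_ifs <;> omega

theorem form_eps_lo (i : Fin (rk m n)) (y : Wt m n) :
    D.form (eps (lo i)) y = sgn (D.parity (lo i)) * y i := by
  simp [form, eps_lo, Pi.single_apply]

theorem eps_eq_zero {r : Fin (m + n)} (hr : r.rev = r) : (eps r : Wt m n) = 0 := by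
  have h := eps_rev r
  rw [hr] at h
  exact self_eq_neg.mp h

theorem cartan_comm (i j : Fin (rk m n)) : D.cartan i j = D.cartan j i := D.form_comm _ _

variable {D} {i j k : Fin (rk m n)}

theorem IsLong.cartan_eq (h : D.IsLong i) :
    D.cartan i j = 2 * (sgn (D.parity (lo i)) * D.simpleRoot j i) := by
  rw [cartan, simpleRoot, if_pos h, form_smul_left, form_eps_lo]

theorem IsFork.simpleRoot_eq (hn : Even n) (h : D.IsFork i) (hk : (k : ℕ) + 1 = i) :
    D.simpleRoot i = eps (lo k) + eps (lo i) := by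
  rw [simpleRoot, if_neg fun h' => IsLong.not_isFork h' h, row_of_isFork h, h.nx_eq hn, eps_rev,
    sub_neg_eq_add]
  congr 2
  simp only [pv, lo, Fin.ext_iff]; omega

theorem IsFork.cartan_eq (hn : Even n) (h : D.IsFork i) (hk : (k : ℕ) + 1 = i) :
    D.cartan i j = sgn (D.parity (lo k)) * D.simpleRoot j k +
      sgn (D.parity (lo i)) * D.simpleRoot j i := by
  rw [cartan, h.simpleRoot_eq hn hk, form_add_left, form_eps_lo, form_eps_lo]

theorem cartan_of_next (hL : ¬ D.IsLong i) (hF : ¬ D.IsFork i) (hk : (k : ℕ) = i + 1) :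
    D.cartan i j = sgn (D.parity (lo i)) * D.simpleRoot j i -
      sgn (D.parity (lo k)) * D.simpleRoot j k := by
  have : nx i = lo k := by simp only [nx, lo, Fin.ext_iff]; omega
  rw [cartan, simpleRoot, if_neg hL, row_of_not_isFork hF, this, form_sub_left, form_eps_lo,
    form_eps_lo]

/-- Here N is odd and `nx i` is the middle index, so α_s = ε_s. -/
theorem cartan_of_last (hn : Even n) (hL : ¬ D.IsLong i) (hF : ¬ D.IsFork i)
    (hi : (i : ℕ) + 1 = rk m n) :
    D.cartan i j = sgn (D.parity (lo i)) * D.simpleRoot j i := by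
  have h1 := last_odd hn hL hF hi
  have : (nx i).rev = nx i := by
    unfold rk at hi
    simp only [nx, Fin.ext_iff, Fin.val_rev]; omega
  rw [cartan, simpleRoot, if_neg hL, row_of_not_isFork hF, eps_eq_zero this, sub_zero,
    form_eps_lo]

/-- With m and n even, N > 2 means N ≥ 4, so s ≥ 2. Otherwise the truncated subtraction in `pv`
would return the index itself. -/
theorem IsFork.pos (hn : Even n) (hN : 2 < m + n) (h : D.IsFork i) : 0 < (i : ℕ) := by
  obtain ⟨a, ha⟩ := hn
  obtain ⟨b, hb⟩ := h.1
  have := h.2.1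
  unfold rk at this
  omega

theorem IsFork.exists_prev (hn : Even n) (hN : 2 < m + n) (h : D.IsFork i) :
    ∃ k : Fin (rk m n), (k : ℕ) + 1 = i := by
  have := h.pos hn hN
  exact ⟨⟨i - 1, by omega⟩, by simp; omega⟩

theorem not_isLong_of_lt (h : (i : ℕ) < j) : ¬ D.IsLong i := fun h' => by
  have := h'.2.1
  omega

theorem not_isFork_of_lt (h : (i : ℕ) < j) : ¬ D.IsFork i := fun h' => by
  have := h'.2.1
  omega

theorem exists_next (h : (i : ℕ) < j) : ∃ k : Fin (rk m n), (k : ℕ) = i + 1 :=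
  ⟨⟨i + 1, by omega⟩, rfl⟩

theorem simpleRoot_self (hn : Even n) (hN : 2 < m + n) (i : Fin (rk m n)) :
    D.IsLong i ∧ D.simpleRoot i i = 2 ∨ ¬ D.IsLong i ∧ D.simpleRoot i i = 1 := by
  rw [simpleRoot_apply D hn hN]
  by_cases hL : D.IsLong i
  · simp [hL]
  · by_cases hF : D.IsFork i <;> simp [hL, hF]

theorem simpleRoot_of_lt (hn : Even n) (hN : 2 < m + n) (h : (k : ℕ) < i) :
    D.simpleRoot i k = 0 ∨ (D.IsFork i ∧ (k : ℕ) + 1 = i ∧ D.simpleRoot i k = 1) := by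
  rw [simpleRoot_apply D hn hN]
  by_cases hL : D.IsLong i
  · simp [hL, h.ne]
  · by_cases hF : D.IsFork i
    · by_cases hk : (k : ℕ) + 1 = i <;> simp [hL, hF, hk, h.ne]
    · have : (k : ℕ) ≠ i + 1 := by omega
      simp [hL, hF, h.ne, this]

theorem simpleRoot_next (hn : Even n) (hN : 2 < m + n) (h : (k : ℕ) = i + 1) :
    D.simpleRoot i k = -1 := by
  have hlt : (i : ℕ) < k := by omega
  rw [simpleRoot_apply D hn hN, if_neg (not_isLong_of_lt hlt), if_neg (not_isFork_of_lt hlt),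
    if_neg (by omega), if_pos h]

theorem simpleRoot_of_next_lt (hn : Even n) (hN : 2 < m + n) (h : (i : ℕ) + 1 < k) :
    D.simpleRoot i k = 0 := by
  have hlt : (i : ℕ) < k := by omega
  rw [simpleRoot_apply D hn hN, if_neg (not_isLong_of_lt hlt), if_neg (not_isFork_of_lt hlt),
    if_neg (by omega), if_neg (by omega)]

theorem simpleRoot_self_of_lt (hn : Even n) (hN : 2 < m + n) (h : (i : ℕ) < j) :
    D.simpleRoot i i = 1 :=
  (simpleRoot_self hn hN i).elim (fun h' => absurd h'.1 (not_isLong_of_lt h)) And.right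

/-! ### Combinations of simple roots that do not occur in End(V) -/

/-- The differences of two simple roots are not weight differences, apart from the two
end nodes of a fork. -/
theorem large_sub_of_lt (hn : Even n) (hN : 2 < m + n) (hij : (i : ℕ) < j)
    (h : ¬ (D.IsFork j ∧ (i : ℕ) + 1 = j)) : Large (D.simpleRoot i - D.simpleRoot j) := by
  have hi := simpleRoot_self_of_lt hn hN hij (D := D)
  have hji : D.simpleRoot j i = 0 :=
    (simpleRoot_of_lt hn hN hij).resolve_right fun h' => h ⟨h'.1, h'.2.1⟩
  by_cases h1 : (j : ℕ) = i + 1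
  · refine Or.inl ⟨i, j, by omega, ?_⟩
    rw [Pi.sub_apply, Pi.sub_apply, hi, hji, simpleRoot_next hn hN h1]
    rcases simpleRoot_self (D := D) hn hN j with ⟨-, hj⟩ | ⟨-, hj⟩ <;> rw [hj] <;> decide
  · obtain ⟨k, hk⟩ := exists_next hij
    -- The coordinates are 1 at `i`, at most -1 at `k = i + 1` (a fork at `j` can only lower it),
    -- and at most -1 at `j`.
    refine Or.inr ⟨i, k, j, by omega, by omega, by omega, ?_⟩
    simp only [Pi.sub_apply]
    rw [hi, hji, simpleRoot_next hn hN hk, simpleRoot_of_next_lt hn hN (by omega : (i : ℕ) + 1 < j)]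
    rcases simpleRoot_self (D := D) hn hN j with ⟨-, hj⟩ | ⟨-, hj⟩ <;>
    rcases simpleRoot_of_lt (D := D) hn hN (by omega : (k : ℕ) < j) with hjk | ⟨-, -, hjk⟩ <;>
    rw [hj, hjk] <;> decide

theorem large_sub (hn : Even n) (hN : 2 < m + n) (hij : i ≠ j)
    (h : ¬ (D.IsFork j ∧ (i : ℕ) + 1 = j)) (h' : ¬ (D.IsFork i ∧ (j : ℕ) + 1 = i)) :
    Large (D.simpleRoot i - D.simpleRoot j) := by
  rcases lt_or_gt_of_ne (Fin.val_ne_of_ne hij) with hlt | hlt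
  · exact large_sub_of_lt hn hN hlt h
  · rw [← neg_sub]
    exact (large_sub_of_lt hn hN hlt h').neg

theorem sgn_ne_zero (a : ZMod 2) : sgn a ≠ 0 := by
  rcases sgn_cases a with h | h <;> simp [h.1]

/-- As α_j has coordinate 0 at `i`, orthogonality forces it to vanish at `i + 1` too. The supports
are then disjoint, and the coordinates at `i`, `i + 1` and `j` contribute at least 1 each. -/
theorem large_add_of_lt (hn : Even n) (hN : 2 < m + n) (hij : (i : ℕ) < j)
    (h : ¬ (D.IsFork j ∧ (i : ℕ) + 1 = j)) (ha : D.cartan i j = 0) :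
    Large (D.simpleRoot i + D.simpleRoot j) := by
  obtain ⟨k, hk⟩ := exists_next hij
  have hi := simpleRoot_self_of_lt hn hN hij (D := D)
  have hji : D.simpleRoot j i = 0 :=
    (simpleRoot_of_lt hn hN hij).resolve_right fun h' => h ⟨h'.1, h'.2.1⟩
  have hjk : D.simpleRoot j k = 0 := by
    rw [cartan_of_next (not_isLong_of_lt hij) (not_isFork_of_lt hij) hk, hji] at ha
    simpa [sgn_ne_zero] using ha
  have hj := simpleRoot_self (D := D) hn hN j
  have hkj : k ≠ j := by
    rintro rfl
    omega
  refine Or.inr ⟨i, k, j, by omega, by omega, hkj, ?_⟩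
  simp only [Pi.add_apply]
  rw [hi, hji, hjk, simpleRoot_next hn hN hk,
    simpleRoot_of_next_lt hn hN (by omega : (i : ℕ) + 1 < j)]
  rcases hj with ⟨-, hj⟩ | ⟨-, hj⟩ <;> rw [hj] <;> decide

theorem large_add (hn : Even n) (hN : 2 < m + n) (hij : i ≠ j)
    (h : ¬ (D.IsFork j ∧ (i : ℕ) + 1 = j)) (h' : ¬ (D.IsFork i ∧ (j : ℕ) + 1 = i))
    (ha : D.cartan i j = 0) : Large (D.simpleRoot i + D.simpleRoot j) := by
  rcases lt_or_gt_of_ne (Fin.val_ne_of_ne hij) with hlt | hlt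
  · exact large_add_of_lt hn hN hlt h ha
  · rw [add_comm]
    exact large_add_of_lt hn hN hlt h' (D.cartan_comm i j ▸ ha)

theorem IsFork.simpleRoot_self (hn : Even n) (hN : 2 < m + n) (h : D.IsFork i) :
    D.simpleRoot i i = 1 :=
  (ParityData.simpleRoot_self hn hN i).elim (fun h' => absurd h h'.1.not_isFork) And.right

theorem IsFork.simpleRoot_prev (hn : Even n) (hN : 2 < m + n) (h : D.IsFork i)
    (hk : (k : ℕ) + 1 = i) : D.simpleRoot i k = 1 := by
  rw [simpleRoot_apply D hn hN, if_neg fun h' => IsLong.not_isFork h' h, if_pos h,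
    if_pos (Or.inr hk)]

/-- Twice an isotropic simple root is not a weight difference. -/
theorem large_two_smul (hn : Even n) (hN : 2 < m + n) (h : D.cartan i i = 0) :
    Large (D.simpleRoot i + D.simpleRoot i) := by
  -- The roots 2ε_s and ε_s are not isotropic; any other simple root has two coordinates ±1, so its
  -- double has total 4.
  have hi := simpleRoot_self (D := D) hn hN i
  have h1 := sgn_ne_zero (D.parity (lo i))
  by_cases hL : D.IsLong i
  · rw [hL.cartan_eq, (hi.resolve_right fun h' => h'.1 hL).2] at h
    omega
  by_cases hF : D.IsFork i
  · obtain ⟨k, hk⟩ := hF.exists_prev hn hN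
    refine Or.inl ⟨i, k, by omega, ?_⟩
    rw [Pi.add_apply, Pi.add_apply, hF.simpleRoot_self hn hN, hF.simpleRoot_prev hn hN hk]
    decide
  have hi := (hi.resolve_left fun h' => hL h'.1).2
  by_cases hlast : (i : ℕ) + 1 = rk m n
  · rw [cartan_of_last hn hL hF hlast, hi] at h
    omega
  · refine Or.inl ⟨i, ⟨i + 1, by omega⟩, by simp [Fin.ext_iff], ?_⟩
    rw [Pi.add_apply, Pi.add_apply, hi, simpleRoot_next hn hN rfl]
    decide

/-- The coordinates, at an earlier root, of a simple root that precedes the last one. -/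
theorem simpleRoot_prev_cases (hn : Even n) (hN : 2 < m + n) (h : (j : ℕ) < i) :
    ((i : ℕ) = j + 1 ∧ D.simpleRoot j i = -1) ∨ ((j : ℕ) + 1 < i ∧ D.simpleRoot j i = 0) := by
  by_cases hji : (i : ℕ) = j + 1
  · exact Or.inl ⟨hji, simpleRoot_next hn hN hji⟩
  · exact Or.inr ⟨by omega, simpleRoot_of_next_lt hn hN (by omega)⟩

/-- The degree of a standard Serre relation is not a weight difference. -/
theorem large_standard (hn : Even n) (hN : 2 < m + n) (hij : i ≠ j) (hi : D.cartan i i ≠ 0)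
    (h : D.cartan i j ≠ 0) :
    Large (((1 - 2 * D.cartan i j / D.cartan i i).toNat : ℤ) • D.simpleRoot i +
      D.simpleRoot j) := by
  have hii := simpleRoot_self (D := D) hn hN i
  have hi2 := i.2
  have hj2 := j.2
  have hij' := Fin.val_ne_of_ne hij
  have hs := sgn_cases (D.parity (lo i))
  by_cases hL : D.IsLong i
  · have hl := hL.2.1
    have hlt : (j : ℕ) < i := by omega
    have hii := (hii.resolve_right fun h' => h'.1 hL).2
    rw [hL.cartan_eq] at h
    rw [hL.cartan_eq, hL.cartan_eq, hii]
    obtain ⟨hji, hv⟩ := (simpleRoot_prev_cases (D := D) hn hN hlt).resolve_right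
      fun h' => h (by simp [h'.2])
    -- There are two factors; the coordinate at `i` alone is 2 · 2 - 1 = 3.
    refine Or.inl ⟨i, j, hij, ?_⟩
    simp only [Pi.add_apply, Pi.smul_apply, hv, hii, simpleRoot_self_of_lt hn hN hlt]
    rcases hs with ⟨hs, -⟩ | ⟨hs, -⟩ <;> norm_num [hs]
  have hii := (hii.resolve_left fun h' => hL h'.1).2
  by_cases hF : D.IsFork i
  · obtain ⟨k, hk⟩ := hF.exists_prev hn hN
    have hl := hF.2.1
    have hlt : (j : ℕ) < i := by omega
    have hik := hF.simpleRoot_prev hn hN hk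
    rw [hF.cartan_eq hn hk, hii, hik] at hi
    rw [hF.cartan_eq hn hk] at h
    rw [hF.cartan_eq hn hk, hF.cartan_eq hn hk, hii, hik]
    -- A non-isotropic root has the same sign at its two coordinates.
    have hsk : sgn (D.parity (lo k)) = sgn (D.parity (lo i)) := by
      have := sgn_cases (D.parity (lo k))
      omega
    obtain ⟨hv, hw⟩ : D.simpleRoot j k = -1 ∧ D.simpleRoot j i = 0 := by
      rw [hsk, ← mul_add] at h
      have h := right_ne_zero_of_mul h
      -- The two ends of the fork are orthogonal when the signs agree, so `j = k` contradicts `h`.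
      by_cases hjk : j = k
      · subst hjk
        rw [simpleRoot_self_of_lt hn hN hlt, simpleRoot_next hn hN hk.symm] at h
        exact absurd rfl h
      · have hlt' : (j : ℕ) < k := by omega
        have hw := simpleRoot_of_next_lt (D := D) hn hN (by omega : (j : ℕ) + 1 < i)
        exact ⟨((simpleRoot_prev_cases (D := D) hn hN hlt').resolve_right
          fun h' => h (by rw [h'.2, hw, add_zero])).2, hw⟩
    -- There are two factors; the coordinates are 2 and 2 - 1.
    refine Or.inl ⟨i, k, by omega, ?_⟩
    simp only [Pi.add_apply, Pi.smul_apply, hii, hik, hv, hw, hsk]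
    rcases hs with ⟨hs, -⟩ | ⟨hs, -⟩ <;> norm_num [hs]
  by_cases hlast : (i : ℕ) + 1 = rk m n
  · have hlt : (j : ℕ) < i := by omega
    rw [cartan_of_last hn hL hF hlast] at h
    rw [cartan_of_last hn hL hF hlast, cartan_of_last hn hL hF hlast, hii]
    obtain ⟨hji, hv⟩ := (simpleRoot_prev_cases (D := D) hn hN hlt).resolve_right
      fun h' => h (by simp [h'.2])
    have hij0 := (simpleRoot_of_lt (D := D) hn hN hlt).resolve_right fun h' => hF h'.1
    -- For α_i = ε_s there are three factors; the coordinates are 3 - 1 and 1.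
    refine Or.inl ⟨i, j, hij, ?_⟩
    simp only [Pi.add_apply, Pi.smul_apply, hv, hii, hij0, simpleRoot_self_of_lt hn hN hlt]
    rcases hs with ⟨hs, -⟩ | ⟨hs, -⟩ <;> norm_num [hs]
  · have hlt : (i : ℕ) + 1 < rk m n := by omega
    obtain ⟨k, hk⟩ : ∃ k : Fin (rk m n), (k : ℕ) = i + 1 := ⟨⟨i + 1, hlt⟩, rfl⟩
    have hik := simpleRoot_next (D := D) hn hN hk
    rw [cartan_of_next hL hF hk, hii, hik] at hi
    rw [cartan_of_next hL hF hk] at h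
    rw [cartan_of_next hL hF hk, cartan_of_next hL hF hk, hii, hik]
    have hsk : sgn (D.parity (lo k)) = sgn (D.parity (lo i)) := by
      have := sgn_cases (D.parity (lo k))
      omega
    have hvw : (D.simpleRoot j i = -1 ∧ D.simpleRoot j k = 0) ∨
        (D.simpleRoot j i = 0 ∧ (D.simpleRoot j k = 1 ∨ D.simpleRoot j k = 2)) := by
      rw [hsk, ← mul_sub] at h
      have h := right_ne_zero_of_mul h
      rcases lt_or_gt_of_ne hij' with hlt' | hlt'
      · rcases simpleRoot_of_lt (D := D) hn hN hlt' with h0 | ⟨hjF, hj, h0⟩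
        · rcases eq_or_lt_of_le (by omega : (k : ℕ) ≤ j) with hkj | hkj
          · obtain rfl : k = j := Fin.ext hkj
            exact Or.inr ⟨h0, (simpleRoot_self hn hN k).symm.imp And.right And.right⟩
          · have := (simpleRoot_of_lt (D := D) hn hN hkj).resolve_left fun h' => h (by rw [h0, h']; rfl)
            exact Or.inr ⟨h0, Or.inl this.2.2⟩
        · obtain rfl : k = j := by omega
          rw [h0, hjF.simpleRoot_self hn hN] at h
          exact absurd rfl h
      · have hw := simpleRoot_of_next_lt (D := D) hn hN (by omega : (j : ℕ) + 1 < k)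
        exact Or.inl ⟨((simpleRoot_prev_cases (D := D) hn hN hlt').resolve_right
          fun h' => h (by rw [h'.2, hw]; rfl)).2, hw⟩
    -- The coordinates at `i` and `k` are (2 - 1, -2) or (2, -2 + 1) with two factors, and (3, -3 +
    -- 2) with three factors when α_j has coordinate 2 at `k`.
    refine Or.inl ⟨i, k, by omega, ?_⟩
    simp only [Pi.add_apply, Pi.smul_apply, hii, hik, hsk]
    rcases hs with ⟨hs, -⟩ | ⟨hs, -⟩ <;>
    rcases hvw with ⟨hv, hw⟩ | ⟨hv, hw | hw⟩ <;> norm_num [hs, hv, hw]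

/-- The degree of a quartic Serre relation is not a weight difference. -/
theorem large_quartic (hn : Even n) (hN : 2 < m + n) (hij : i < j) (hjk : j < k)
    (hj : D.cartan j j = 0) (h0 : D.cartan i j ≠ 0) (h : D.cartan i j + D.cartan j k = 0) :
    Large (D.simpleRoot i + D.simpleRoot j + D.simpleRoot k + D.simpleRoot j) := by
  rw [Fin.lt_def] at hij hjk
  obtain ⟨l, hl⟩ := exists_next hjk
  have hii := simpleRoot_self_of_lt hn hN hij (D := D)
  have hjj := simpleRoot_self_of_lt hn hN hjk (D := D)
  have hjl := simpleRoot_next hn hN hl (D := D)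
  have hji := (simpleRoot_of_lt (D := D) hn hN hij).resolve_right
    fun h' => not_isFork_of_lt hjk h'.1
  have hil := simpleRoot_of_next_lt (D := D) hn hN (by omega : (i : ℕ) + 1 < l)
  have hki := (simpleRoot_of_lt (D := D) hn hN (hij.trans hjk)).resolve_right
    fun h' => by omega
  rw [cartan_comm] at h h0
  have e : ∀ x, D.cartan j x = _ := fun x =>
    cartan_of_next (not_isLong_of_lt hjk) (not_isFork_of_lt hjk) hl
  rw [e] at hj h0 h
  rw [e] at h
  rw [hil, mul_zero, sub_zero] at h h0
  have hij1 := ((simpleRoot_prev_cases (D := D) hn hN hij).resolve_right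
    fun h' => h0 (by rw [h'.2, mul_zero])).2
  refine Or.inr ⟨i, j, l, by omega, by omega, by omega, ?_⟩
  simp only [Pi.add_apply]
  rw [hjj, hjl] at hj
  -- Isotropy of α_j makes the signs at `j` and `l` opposite, which turns a_ij + a_jk = 0 into x + y
  -- = 1 for the coordinates x, y of α_k at `j`, `l`. As x is 0 or 1, the total is at least 1 + (1 +
  -- x) + (2 - y) = 3 + 2x.
  have hsum : D.simpleRoot k j + D.simpleRoot k l = 1 := by
    rcases sgn_cases (D.parity (lo j)) with ⟨hs, -⟩ | ⟨hs, -⟩ <;>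
    rcases sgn_cases (D.parity (lo l)) with ⟨hs', -⟩ | ⟨hs', -⟩ <;>
    rw [hs, hs'] at hj h <;> rw [hij1] at h <;> omega
  rw [hii, hjj, hjl, hji, hil, hki, hij1]
  have a1 := le_abs_self (-1 + 1 + D.simpleRoot k j + 1)
  have a2 := neg_le_abs (0 + -1 + D.simpleRoot k l + -1)
  have a3 : |(1 : ℤ) + 0 + 0 + 0| = 1 := by decide
  have hkj := simpleRoot_of_lt (D := D) hn hN hjk
  rw [a3]
  omega

/-- The degree of a sextic Serre relation is not a weight difference. -/
theorem large_sextic (hn : Even n) (hN : 2 < m + n) (hij : (i : ℕ) + 1 = j)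
    (hjk : (j : ℕ) + 1 = k) (pk : D.parity (lo k) = 1) :
    Large (D.simpleRoot i + D.simpleRoot j + (D.simpleRoot i + D.simpleRoot j + D.simpleRoot k) +
      D.simpleRoot j) := by
  have hF : ¬ D.IsFork k := fun h => absurd (pk.symm.trans h.2.2) (by decide)
  have hij' : (i : ℕ) < j := by omega
  have hjk' : (j : ℕ) < k := by omega
  -- The degree is 2α_i + 3α_j + α_k, with coordinates 2 at `i` and -2 + 3 at `j`.
  refine Or.inl ⟨i, j, by omega, ?_⟩
  simp only [Pi.add_apply]
  rw [simpleRoot_self_of_lt hn hN hij', simpleRoot_self_of_lt hn hN hjk',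
    simpleRoot_next hn hN hij.symm,
    (simpleRoot_of_lt (D := D) hn hN hij').resolve_right
      fun h => not_isFork_of_lt hjk' h.1,
    (simpleRoot_of_lt (D := D) hn hN hjk').resolve_right fun h => hF h.1,
    (simpleRoot_of_lt (D := D) hn hN (hij'.trans hjk')).resolve_right fun h => hF h.1]
  decide

/-- The degree of a septic Serre relation is not a weight difference. -/
theorem large_septic (hn : Even n) (hN : 2 < m + n) {l : Fin (rk m n)} (hli : (l : ℕ) + 1 = i)
    (hij : (i : ℕ) + 1 = j) (hjk : (j : ℕ) + 1 = k) (pk : D.parity (lo k) = 1) :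
    Large (D.simpleRoot l + D.simpleRoot i + D.simpleRoot j + D.simpleRoot k + D.simpleRoot j +
      D.simpleRoot i + D.simpleRoot j) := by
  have hF : ¬ D.IsFork k := fun h => absurd (pk.symm.trans h.2.2) (by decide)
  have hli' : (l : ℕ) < i := by omega
  have hij' : (i : ℕ) < j := by omega
  have hjk' : (j : ℕ) < k := by omega
  have e : ∀ {a b c : Fin (rk m n)}, (a : ℕ) < b → (b : ℕ) < c → D.simpleRoot b a = 0 :=
    fun hab hbc => (simpleRoot_of_lt (D := D) hn hN hab).resolve_right
      fun h => not_isFork_of_lt hbc h.1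
  have e' : ∀ {a : Fin (rk m n)}, (a : ℕ) < k → D.simpleRoot k a = 0 :=
    fun h => (simpleRoot_of_lt (D := D) hn hN h).resolve_right fun h => hF h.1
  -- The degree is α_l + 2α_i + 3α_j + α_k, with coordinates 1, -1 + 2 and -2 + 3.
  refine Or.inr ⟨l, i, j, by omega, by omega, by omega, ?_⟩
  simp only [Pi.add_apply]
  rw [simpleRoot_self_of_lt hn hN hli', simpleRoot_self_of_lt hn hN hij',
    simpleRoot_self_of_lt hn hN hjk', simpleRoot_next hn hN hli.symm,
    simpleRoot_next hn hN hij.symm, simpleRoot_of_next_lt (D := D) hn hN (by omega : (l : ℕ) + 1 < j),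
    e hli' hij', e hij' hjk', e (hli'.trans hij') hjk', e' hjk', e' (hij'.trans hjk'),
    e' (by omega : (l : ℕ) < k)]
  decide

end ParityData

/-! ### The Chevalley generators as homogeneous matrices -/

namespace ParityData

variable {D : ParityData m n} {i j k : Fin (rk m n)}

theorem row_ne_nx (i : Fin (rk m n)) : D.row i ≠ nx i := by
  by_cases hF : D.IsFork i
  · rw [row_of_isFork hF]
    simp only [pv, nx, ne_eq, Fin.ext_iff]; omega
  · rw [row_of_not_isFork hF]
    simp only [lo, nx, ne_eq, Fin.ext_iff]; omega

/-- Only for 2ε_s are the two indices mirror images. Elsewhere this kills the cross terms in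
products of the root vectors. -/
theorem row_ne_rev_nx (hn : Even n) (hN : 2 < m + n) (hL : ¬ D.IsLong i) :
    D.row i ≠ (nx i).rev := by
  by_cases hF : D.IsFork i
  · have := hF.pos hn hN
    rw [row_of_isFork hF, hF.nx_eq hn, Fin.rev_rev]
    simp only [pv, lo, ne_eq, Fin.ext_iff]; omega
  · have h1 := last_odd hn hL hF
    have h2 := i.2
    rw [row_of_not_isFork hF]
    unfold rk at h1 h2
    simp only [lo, nx, ne_eq, Fin.ext_iff, Fin.val_rev]; omega

theorem isGraded_X {G : Type*} [AddCommGroup G] {w : Fin (m + n) → G} {a b : Fin (m + n)} {g : G}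
    (h : w a - w b = g) (h' : w b.rev - w a.rev = g) : IsGraded w (D.X a b) g :=
  (IsGraded.single _ h).sub (IsGraded.single _ h')

theorem isGraded_eps_X (a b : Fin (m + n)) : IsGraded eps (D.X a b) (eps a - eps b) :=
  isGraded_X rfl (by rw [eps_rev, eps_rev]; abel)

theorem isGraded_parity_X (a b : Fin (m + n)) :
    IsGraded D.parity (D.X a b) (D.parity a + D.parity b) :=
  isGraded_X (CharTwo.sub_eq_add _ _)
    (by rw [D.parity_rev, D.parity_rev, CharTwo.sub_eq_add, add_comm])

theorem simpleRoot_of_not_isLong (hL : ¬ D.IsLong i) :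
    D.simpleRoot i = eps (D.row i) - eps (nx i) := if_neg hL

theorem IsLong.simpleRoot_eq (hn : Even n) (hL : D.IsLong i) :
    D.simpleRoot i = eps (lo i) - eps (nx i) := by
  rw [hL.nx_eq hn, eps_rev, sub_neg_eq_add, ← two_smul ℤ]
  exact if_pos hL

theorem chevE_of_not_isLong (hL : ¬ D.IsLong i) : D.chevE i = D.X (D.row i) (nx i) := if_neg hL

theorem chevF_of_not_isLong (hL : ¬ D.IsLong i) :
    D.chevF i = sgn (D.parity (D.row i)) • D.X (nx i) (D.row i) := if_neg hL

theorem chevH_of_not_isLong (hL : ¬ D.IsLong i) :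
    D.chevH i = sgn (D.parity (D.row i)) • D.X (D.row i) (D.row i) -
      sgn (D.parity (nx i)) • D.X (nx i) (nx i) := if_neg hL

theorem isGraded_eps_chevE (hn : Even n) (i : Fin (rk m n)) :
    IsGraded eps (D.chevE i) (D.simpleRoot i) := by
  by_cases hL : D.IsLong i
  · rw [hL.simpleRoot_eq hn, chevE, if_pos hL]
    exact IsGraded.single _ rfl
  · rw [simpleRoot_of_not_isLong hL, chevE_of_not_isLong hL]
    exact isGraded_eps_X _ _

theorem isGraded_eps_chevF (hn : Even n) (i : Fin (rk m n)) :
    IsGraded eps (D.chevF i) (-D.simpleRoot i) := by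
  by_cases hL : D.IsLong i
  · rw [hL.simpleRoot_eq hn, chevF, if_pos hL, neg_sub]
    exact IsGraded.single _ rfl
  · rw [simpleRoot_of_not_isLong hL, chevF_of_not_isLong hL, neg_sub]
    exact (isGraded_eps_X _ _).smul _

theorem isGraded_parity_chevE (i : Fin (rk m n)) :
    IsGraded D.parity (D.chevE i) (D.rootParity i) := by
  by_cases hL : D.IsLong i
  · rw [rootParity, row_of_not_isFork hL.not_isFork, chevE, if_pos hL]
    exact IsGraded.single _ (CharTwo.sub_eq_add _ _)
  · rw [chevE_of_not_isLong hL]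
    exact isGraded_parity_X _ _

theorem isGraded_parity_chevF (i : Fin (rk m n)) :
    IsGraded D.parity (D.chevF i) (D.rootParity i) := by
  by_cases hL : D.IsLong i
  · rw [rootParity, row_of_not_isFork hL.not_isFork, chevF, if_pos hL]
    exact IsGraded.single _ ((CharTwo.sub_eq_add _ _).trans (add_comm _ _))
  · rw [chevF_of_not_isLong hL, rootParity, add_comm (D.parity _)]
    exact (isGraded_parity_X _ _).smul _

theorem theta_mul_self (a : Fin (m + n)) : (D.theta a : ℤ) * D.theta a = 1 := by
  rw [← Units.val_mul, Int.units_mul_self, Units.val_one]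

theorem X_self (a : Fin (m + n)) :
    D.X a a = diagonal fun t => (if t = a then 1 else 0) - (if t = a.rev then 1 else 0) := by
  have h : sgn (D.parity a * (D.parity a + D.parity a)) = 1 := by
    rw [CharTwo.add_self_eq_zero, mul_zero]; rfl
  rw [X, h, one_mul, theta_mul_self]
  ext t r
  simp only [Matrix.sub_apply, Matrix.single_apply, Matrix.diagonal_apply]
  by_cases htr : t = r
  · subst htr
    simp [eq_comm]
  · have h1 : ∀ b, ¬ (b = t ∧ b = r) := fun b hb => htr (hb.1.symm.trans hb.2)
    rw [if_neg (h1 _), if_neg (h1 _), if_neg htr, sub_zero]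

theorem eps_apply_eq_X (k : Fin (rk m n)) (t : Fin (m + n)) :
    eps t k = D.X (lo k) (lo k) t t := by
  have hk := k.2
  unfold rk at hk
  simp only [eps, X_self, diagonal_apply_eq, lo, Fin.ext_iff, Fin.val_rev]
  split_ifs <;> omega

theorem X_rev_self (a : Fin (m + n)) : D.X a.rev a.rev = -D.X a a := by
  simp [X_self, diagonal_neg]

/-- Every basis index is `k`, `k'` or the middle one. -/
theorem index_cases (a : Fin (m + n)) :
    (∃ k : Fin (rk m n), a = lo k) ∨ (∃ k : Fin (rk m n), a = (lo k).rev) ∨ a.rev = a := by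
  have ha := a.2
  simp only [lo, Fin.ext_iff, Fin.val_rev]
  rcases lt_trichotomy ((a : ℕ) + 1) (m + n - a) with h | h | h
  · exact Or.inl ⟨⟨a, by unfold rk; omega⟩, rfl⟩
  · exact Or.inr (Or.inr (by omega))
  · refine Or.inr (Or.inl ⟨⟨m + n - (a + 1), by unfold rk; omega⟩, ?_⟩)
    simp only
    omega

theorem form_eps_eps (a t : Fin (m + n)) :
    D.form (eps a) (eps t) = sgn (D.parity a) * D.X a a t t := by
  rcases index_cases a with ⟨k, rfl⟩ | ⟨k, rfl⟩ | h
  · rw [form_eps_lo, eps_apply_eq_X]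
  · rw [eps_rev, form_neg_left, form_eps_lo, eps_apply_eq_X, X_rev_self, D.parity_rev,
      Matrix.neg_apply, mul_neg]
  · rw [eps_eq_zero h, X_self, h]
    simp [form]

/-- Ties the matrices 𝗁_i to the form on weights, so that conjugation by q^{𝗁_i/2} can be read off
from degrees. -/
theorem chevH_apply_self (i : Fin (rk m n)) (t : Fin (m + n)) :
    D.chevH i t t = D.form (D.simpleRoot i) (eps t) := by
  by_cases hL : D.IsLong i
  · rw [chevH, if_pos hL, simpleRoot, if_pos hL, form_smul_left, form_eps_eps, hL.2.2]
    simp [sgn, ZMod.val_one]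
  · rw [chevH_of_not_isLong hL, simpleRoot_of_not_isLong hL, form_sub_left, form_eps_eps,
      form_eps_eps]
    rfl

theorem chevH_eq_diagonal (i : Fin (rk m n)) :
    D.chevH i = diagonal fun t => D.chevH i t t := by
  by_cases hL : D.IsLong i
  · rw [chevH, if_pos hL, X_self, ← diagonal_smul]
    simp
  · rw [chevH_of_not_isLong hL, X_self, X_self, ← diagonal_smul, ← diagonal_smul, diagonal_sub]
    simp

/-- The indices `D.row i` and `nx i` are neither equal nor mirror images, so at most one of the two
diagonal terms is nonzero at `t`. -/
theorem chevH_apply_cases (hn : Even n) (hN : 2 < m + n) (hL : ¬ D.IsLong i) (t : Fin (m + n)) :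
    D.chevH i t t = -1 ∨ D.chevH i t t = 0 ∨ D.chevH i t t = 1 := by
  have h1 := row_ne_nx (D := D) i
  have h2 := row_ne_rev_nx hn hN hL
  rw [chevH_of_not_isLong hL, X_self, X_self]
  generalize D.row i = a at *
  generalize nx i = b at *
  simp only [Matrix.sub_apply, Matrix.smul_apply, diagonal_apply_eq, smul_eq_mul]
  have ha := sgn_cases (D.parity a)
  have hb := sgn_cases (D.parity b)
  simp only [Fin.ext_iff, Fin.val_rev, ne_eq] at *
  split_ifs <;> omega

/-! ### Products of the matrices X_{ab} -/

section Products

variable (D) {a b : Fin (m + n)}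

/-- The sign of the second term of `X a b`. -/
def coef (a b : Fin (m + n)) : ℤ :=
  sgn (D.parity a * (D.parity a + D.parity b)) * (D.theta a : ℤ) * (D.theta b : ℤ)

theorem X_eq (a b : Fin (m + n)) :
    D.X a b = single a b 1 - single b.rev a.rev (D.coef a b) := rfl

theorem coef_mul_coef (a b : Fin (m + n)) :
    D.coef a b * D.coef b a = sgn ((D.parity a + D.parity b) * (D.parity a + D.parity b)) := by
  have h : D.coef a b * D.coef b a =
      sgn (D.parity a * (D.parity a + D.parity b)) * sgn (D.parity b * (D.parity b + D.parity a)) *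
        ((D.theta a : ℤ) * D.theta a) * ((D.theta b : ℤ) * D.theta b) := by
    unfold coef; ring
  rw [h, theta_mul_self, theta_mul_self, mul_one, mul_one]
  generalize D.parity a = x
  generalize D.parity b = y
  revert x y; decide

/-- For even v_b both ϑ_b and ϑ_{b'} are 1: this is the symmetry behind the fork relations. -/
theorem coef_rev_right (hb : D.parity b = 0) : D.coef a b.rev = D.coef a b := by
  rw [coef, coef, D.parity_rev, D.theta_even b hb, D.theta_even b.rev (by rw [D.parity_rev, hb])]

theorem coef_rev_left (hb : D.parity b = 0) : D.coef b.rev a = D.coef b a := by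
  rw [coef, coef, D.parity_rev, D.theta_even b hb, D.theta_even b.rev (by rw [D.parity_rev, hb])]

theorem sgn_mul_add_self (x : ZMod 2) : sgn (x * (x + x)) = 1 := by
  rw [CharTwo.add_self_eq_zero, mul_zero]; rfl

theorem X_superbracket_X (h' : a ≠ b.rev) :
    sgn (D.parity a) • (D.X a b * D.X b a -
        sgn ((D.parity a + D.parity b) * (D.parity a + D.parity b)) • (D.X b a * D.X a b)) =
      sgn (D.parity a) • D.X a a - sgn (D.parity b) • D.X b b := by
  have hc := D.coef_mul_coef a b
  have hc' : D.coef b a * D.coef a b = _ := mul_comm (D.coef b a) _ ▸ hc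
  have h1 : b ≠ a.rev := fun e => h' (by rw [e, Fin.rev_rev])
  have hab : sgn (D.parity a) * sgn ((D.parity a + D.parity b) * (D.parity a + D.parity b)) =
      sgn (D.parity b) := by
    generalize D.parity a = x
    generalize D.parity b = y
    revert x y; decide
  have hself : ∀ c, D.coef c c = 1 := fun c => by
    rw [coef, sgn_mul_add_self, one_mul, theta_mul_self]
  have hs := sgn_mul_self ((D.parity a + D.parity b) * (D.parity a + D.parity b))
  simp only [X_eq, hself, sub_mul, mul_sub,
    single_mul_single_same, single_mul_single_of_ne _ _ _ _ h1,
    single_mul_single_of_ne _ _ _ _ h1.symm, single_mul_single_of_ne _ _ _ _ h',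
    single_mul_single_of_ne _ _ _ _ h'.symm, mul_one, hc, hc', smul_sub, smul_single,
    smul_eq_mul, sub_zero, zero_sub, smul_neg, hs, hab]
  abel

/-- Both products are multiples of E_{b'b}, and `coef_mul_coef` compares the factors. -/
theorem X_mul_X_rev (h : a ≠ b) (h' : a ≠ b.rev) (hb : D.parity b = 0) (hbb : b ≠ b.rev) :
    D.X a b * D.X b.rev a = sgn (D.parity a) • (D.X b.rev a * D.X a b) := by
  have h1 : b ≠ a.rev := fun e => h' (by rw [e, Fin.rev_rev])
  have h2 : a.rev ≠ b.rev := fun e => h (Fin.rev_injective e)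
  have hc := D.coef_mul_coef a b
  have hz : sgn ((D.parity a + 0) * (D.parity a + 0)) = sgn (D.parity a) := by
    generalize D.parity a = x
    revert x; decide
  rw [hb, hz] at hc
  simp only [X_eq, coef_rev_left D hb, Fin.rev_rev, sub_mul, mul_sub,
    single_mul_single_same, single_mul_single_of_ne _ _ _ _ hbb,
    single_mul_single_of_ne _ _ _ _ h1, single_mul_single_of_ne _ _ _ _ h2,
    single_mul_single_of_ne _ _ _ _ h', single_mul_single_of_ne _ _ _ _ h.symm,
    mul_one, hc, smul_single, smul_eq_mul, sub_zero, zero_sub, neg_neg, sub_self]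

/-- Both products are the same multiple of E_{aa'}, because the coefficients for `b` and `b.rev`
agree. -/
theorem commute_X_X_rev (h : a ≠ b) (h' : a ≠ b.rev) (haa : a ≠ a.rev) (hb : D.parity b = 0) :
    Commute (D.X a b) (D.X a b.rev) := by
  have h1 : b ≠ a.rev := fun e => h' (by rw [e, Fin.rev_rev])
  have h2 : a.rev ≠ b.rev := fun e => h (Fin.rev_injective e)
  rw [Commute, SemiconjBy]
  simp only [X_eq, coef_rev_right D hb, Fin.rev_rev, sub_mul, mul_sub, single_mul_single_same,
    single_mul_single_of_ne _ _ _ _ h1.symm, single_mul_single_of_ne _ _ _ _ h2,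
    single_mul_single_of_ne _ _ _ _ h'.symm, single_mul_single_of_ne _ _ _ _ h.symm,
    single_mul_single_of_ne _ _ _ _ haa.symm, one_mul]

theorem commute_X_rev_X (h : a ≠ b) (h' : a ≠ b.rev) (haa : a ≠ a.rev) (hb : D.parity b = 0) :
    Commute (D.X b a) (D.X b.rev a) := by
  have h1 : b ≠ a.rev := fun e => h' (by rw [e, Fin.rev_rev])
  have h2 : a.rev ≠ b.rev := fun e => h (Fin.rev_injective e)
  rw [Commute, SemiconjBy]
  simp only [X_eq, coef_rev_left D hb, Fin.rev_rev, sub_mul, mul_sub, single_mul_single_same,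
    single_mul_single_of_ne _ _ _ _ h1, single_mul_single_of_ne _ _ _ _ h2.symm,
    single_mul_single_of_ne _ _ _ _ h', single_mul_single_of_ne _ _ _ _ h,
    single_mul_single_of_ne _ _ _ _ haa, mul_one]

end Products

/-- The type D cubic relation for matrices of the shape of the root vectors. -/
theorem cubic_matrix {R ι : Type*} [CommRing R] [Fintype ι] [DecidableEq ι]
    {a b c a' b' c' : ι} {x₁ y₁ x₂ y₂ x₃ y₃ u v : R}
    (hac : a ≠ c) (hab' : a ≠ b') (hac' : a ≠ c') (hbc : b ≠ c) (hba' : b ≠ a')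
    (hbc' : b ≠ c') (hca' : c ≠ a') (hcb' : c ≠ b') (hac'' : a' ≠ c') (hbc'' : b' ≠ c')
    (h : x₃ * y₂ = x₂ * y₃) :
    let A := single a b x₁ + single b' a' y₁
    let B := single b c x₂ + single c' b' y₂
    let C := single b c' x₃ + single c b' y₃
    C * (B * A - u • (A * B)) - v • ((B * A - u • (A * B)) * C) =
      B * (C * A - u • (A * C)) - v • ((C * A - u • (A * C)) * B) := by
  intro A B C
  have e : ∀ {i j k l : ι} (x y : R), j ≠ k → single i j x * single k l y = 0 :=
    fun x y hne => single_mul_single_of_ne _ _ _ _ hne _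
  have hBA : B * A = single c' a' (y₂ * y₁) := by
    simp [A, B, add_mul, mul_add, e, hac.symm, hcb', hab'.symm]
  have hAB : A * B = single a c (x₁ * x₂) := by
    simp [A, B, add_mul, mul_add, e, hbc', hba'.symm, hac'']
  have hCA : C * A = single c a' (y₃ * y₁) := by
    simp [A, C, add_mul, mul_add, e, hac'.symm, hbc''.symm, hab'.symm]
  have hAC : A * C = single a c' (x₁ * x₃) := by
    simp [A, C, add_mul, mul_add, e, hbc, hba'.symm, hca'.symm]
  -- On each side only E_{ba'} and E_{ab'} survive; these are the equalities of their coefficients.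
  have h1 : x₃ * (y₂ * y₁) = x₂ * (y₃ * y₁) := by linear_combination y₁ * h
  have h2 : u * (x₁ * x₂) * y₃ = u * (x₁ * x₃) * y₂ := by linear_combination (-u * x₁) * h
  rw [hBA, hAB, hCA, hAC]
  simp [B, C, add_mul, mul_add, mul_sub, sub_mul, e, hbc'', hac'.symm, hab'.symm, hba'.symm,
    hca'.symm, hbc.symm, hcb'.symm, hac.symm, hac'', hbc'.symm, smul_single, h1, h2]

end ParityData

theorem IsGraded.add {ι R G : Type*} [AddCommGroup G] [CommRing R] {w : ι → G} {g : G}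
    {A B : Matrix ι ι R} (hA : IsGraded w A g) (hB : IsGraded w B g) : IsGraded w (A + B) g := by
  intro t r hne
  by_cases h : A t r = 0
  · exact hB t r fun h' => hne (by simp [h, h'])
  · exact hA t r h

/-! ### The ground field and extension of scalars -/

theorem qHalf_ne_zero : qHalf ≠ 0 := RatFunc.X_ne_zero

theorem q_ne_zero : q ≠ 0 := pow_ne_zero 2 qHalf_ne_zero

theorem q_sub_inv_ne_zero : q - q⁻¹ ≠ 0 := by
  intro h
  -- From q = q⁻¹ one gets q² = 1, where q² is the fourth power of the variable; degrees exclude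
  -- this.
  have h1 : (RatFunc.X : K) ^ 4 = 1 := by
    have := mul_inv_cancel₀ q_ne_zero
    rw [← sub_eq_zero.mp h] at this
    rw [← this, q, qHalf]; ring
  rw [← RatFunc.algebraMap_X, ← map_pow, ← map_one (algebraMap (Polynomial ℂ) K)] at h1
  have h2 := congrArg Polynomial.natDegree (RatFunc.algebraMap_injective ℂ h1)
  simp at h2

/-- The matrix over the ground field with given integral entries. -/
abbrev toK : Matrix (Fin (m + n)) (Fin (m + n)) ℤ →+* Matrix (Fin (m + n)) (Fin (m + n)) K :=
  (Int.castRingHom K).mapMatrix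

theorem toK_smul (c : ℤ) (A : Matrix (Fin (m + n)) (Fin (m + n)) ℤ) :
    toK (c • A) = (c : K) • toK A := by
  ext t r
  simp only [toK, RingHom.mapMatrix_apply, Matrix.map_apply, Matrix.smul_apply, smul_eq_mul,
    Int.coe_castRingHom, Int.cast_mul]

theorem toK_single (a b : Fin (m + n)) (c : ℤ) : toK (single a b c) = single a b (c : K) := by
  ext t r
  simp [toK, Matrix.single_apply]

/-! ### The Cartan relations and the relations between e_i and f_i -/

namespace ParityData

variable {D : ParityData m n} {i j k : Fin (rk m n)}

theorem kappa_of_not_isLong (hL : ¬ D.IsLong i) : D.kappa i = 1 := if_neg hL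

variable (D) in
/-- The matrix by which a generator acts on `V`. -/
def genMat : Gen m n → Matrix (Fin (m + n)) (Fin (m + n)) K
  | .e i => toK (D.chevE i)
  | .f i => D.kappa i • toK (D.chevF i)
  | .k i => diagonal fun r => qHalf ^ D.chevH i r r
  | .kInv i => diagonal fun r => qHalf ^ (-D.chevH i) r r

variable (D) in
/-- The action of the free algebra on `V`. -/
def freeRep : Free m n →ₐ[K] Matrix (Fin (m + n)) (Fin (m + n)) K := FreeAlgebra.lift K D.genMat

@[simp]
theorem freeRep_gen (g : Gen m n) : D.freeRep (gen g) = D.genMat g := FreeAlgebra.lift_ι_apply _ _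

theorem isGraded_eps_genMat_e (hn : Even n) (i : Fin (rk m n)) :
    IsGraded eps (D.genMat (.e i)) (D.simpleRoot i) :=
  (isGraded_eps_chevE hn i).map_intCast

theorem isGraded_eps_genMat_f (hn : Even n) (i : Fin (rk m n)) :
    IsGraded eps (D.genMat (.f i)) (-D.simpleRoot i) :=
  (isGraded_eps_chevF hn i).map_intCast.smul _

theorem isGraded_parity_genMat (g : Gen m n) : IsGraded D.parity (D.genMat g) (D.genParity g) := by
  cases g with
  | e i => exact (isGraded_parity_chevE i).map_intCast
  | f i => exact (isGraded_parity_chevF i).map_intCast.smul _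
  | k i => exact IsGraded.diagonal _
  | kInv i => exact IsGraded.diagonal _

theorem genMat_k_mul_genMat_kInv (i : Fin (rk m n)) :
    D.genMat (.k i) * D.genMat (.kInv i) = 1 := by
  rw [genMat, genMat, diagonal_mul_diagonal, ← diagonal_one]
  congr 1
  funext r
  rw [Matrix.neg_apply, _root_.zpow_neg, mul_inv_cancel₀ (zpow_ne_zero _ qHalf_ne_zero)]

theorem genMat_kInv_mul_genMat_k (i : Fin (rk m n)) :
    D.genMat (.kInv i) * D.genMat (.k i) = 1 :=
  mul_eq_one_comm.mp (genMat_k_mul_genMat_kInv i)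

/-- The entry at (t, r) is scaled by the power of q^{1/2} with exponent (α_i, ε_t - ε_r), and ε_t -
ε_r = β wherever the entry is nonzero. -/
theorem genMat_k_conj {A : Matrix (Fin (m + n)) (Fin (m + n)) K} {β : Wt m n}
    (hA : IsGraded eps A β) (i : Fin (rk m n)) :
    D.genMat (.k i) * A * D.genMat (.kInv i) = qHalf ^ D.form (D.simpleRoot i) β • A := by
  ext t r
  rw [genMat, genMat, mul_diagonal, diagonal_mul, Matrix.smul_apply, smul_eq_mul]
  by_cases h : A t r = 0
  · simp [h]
  · rw [← hA t r h, form_sub_right, ← chevH_apply_self, ← chevH_apply_self, Matrix.neg_apply,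
      zpow_sub₀ qHalf_ne_zero, _root_.zpow_neg]
    ring

/-- The Lie superalgebra relation `[𝖾_i, 𝖿_i] = 𝗁_i`. -/
theorem chevE_superbracket_chevF (hn : Even n) (hN : 2 < m + n) (i : Fin (rk m n)) :
    D.chevE i * D.chevF i - sgn (D.rootParity i * D.rootParity i) • (D.chevF i * D.chevE i) =
      D.chevH i := by
  by_cases hL : D.IsLong i
  · have hp : D.rootParity i = 0 := by
      rw [rootParity, row_of_not_isFork hL.not_isFork, hL.nx_eq hn, D.parity_rev,
        CharTwo.add_self_eq_zero]
    have hs : sgn (0 * 0) = 1 := rfl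
    rw [hp, hs, one_smul, chevE, if_pos hL, chevF, if_pos hL, chevH, if_pos hL,
      single_mul_single_same, single_mul_single_same, X_self, hL.nx_eq hn]
    ext t r
    simp only [Matrix.sub_apply, Matrix.smul_apply, Matrix.single_apply, diagonal_apply,
      smul_eq_mul, one_mul, mul_one]
    by_cases htr : t = r
    · subst htr
      simp only [and_self, eq_comm (b := t), if_true]
      split_ifs <;> rfl
    · have h1 : ∀ b, ¬ (b = t ∧ b = r) := fun b hb => htr (hb.1.symm.trans hb.2)
      rw [if_neg (h1 _), if_neg (h1 _), if_neg htr]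
      rfl
  · rw [chevE_of_not_isLong hL, chevF_of_not_isLong hL, chevH_of_not_isLong hL,
      ← D.X_superbracket_X (row_ne_rev_nx hn hN hL), rootParity, mul_smul_comm, smul_mul_assoc,
      smul_comm _ (sgn (D.parity (D.row i))), smul_sub]

/-- The q-number of 0, ±1 is the number itself, while that of ±2 is ±(q + q⁻¹) = ±2κ_s. -/
theorem kappa_mul_chevH (hn : Even n) (hN : 2 < m + n) (i : Fin (rk m n)) (t : Fin (m + n)) :
    D.kappa i * (D.chevH i t t : K) =
      (q - q⁻¹)⁻¹ * ((qHalf ^ D.chevH i t t) ^ 2 - (qHalf ^ (-D.chevH i t t)) ^ 2) := by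
  have hq := q_sub_inv_ne_zero
  have hq' := q_ne_zero
  have h2 : ∀ z : ℤ, (qHalf ^ z) ^ 2 = q ^ z := fun z => by
    rw [q, ← zpow_natCast, ← zpow_natCast, ← _root_.zpow_mul, ← _root_.zpow_mul, mul_comm]
  rw [h2, h2, eq_inv_mul_iff_mul_eq₀ hq]
  by_cases hL : D.IsLong i
  · rw [kappa, if_pos hL]
    have : D.chevH i t t = -2 ∨ D.chevH i t t = 0 ∨ D.chevH i t t = 2 := by
      rw [chevH, if_pos hL, X_self, Matrix.smul_apply, diagonal_apply_eq, smul_eq_mul]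
      split_ifs <;> simp
    rcases this with h | h | h <;> rw [h]
    · push_cast
      rw [_root_.zpow_neg, zpow_ofNat]
      field_simp
      ring
    · simp
    · push_cast
      rw [_root_.zpow_neg, zpow_ofNat]
      field_simp
      ring
  · rw [kappa_of_not_isLong hL, one_mul]
    rcases chevH_apply_cases hn hN hL t with h | h | h <;> rw [h] <;> simp

theorem genMat_e_superbracket_f_self (hn : Even n) (hN : 2 < m + n) (i : Fin (rk m n)) :
    D.genMat (.e i) * D.genMat (.f i) -
        (sgn (D.rootParity i * D.rootParity i) : K) • (D.genMat (.f i) * D.genMat (.e i)) =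
      (q - q⁻¹)⁻¹ • (D.genMat (.k i) ^ 2 - D.genMat (.kInv i) ^ 2) := by
  have h : D.genMat (.e i) * D.genMat (.f i) -
        (sgn (D.rootParity i * D.rootParity i) : K) • (D.genMat (.f i) * D.genMat (.e i)) =
      D.kappa i • toK (D.chevH i) := by
    rw [← chevE_superbracket_chevF hn hN i, map_sub, toK_smul, map_mul, map_mul, genMat, genMat,
      mul_smul_comm, smul_mul_assoc, smul_comm _ (D.kappa i), smul_sub]
  rw [h, chevH_eq_diagonal, genMat, genMat, diagonal_pow, diagonal_pow, diagonal_sub,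
    ← diagonal_smul]
  have : toK (diagonal fun t => D.chevH i t t) = diagonal fun t => (D.chevH i t t : K) := by
    ext t r
    by_cases htr : t = r <;> simp [toK, htr]
  rw [this, ← diagonal_smul]
  congr 1
  funext t
  simp only [Pi.smul_apply, smul_eq_mul, Pi.pow_apply, Matrix.neg_apply]
  exact kappa_mul_chevH hn hN i t

/-! ### The two end nodes of a fork -/

section Fork

theorem IsFork.row_eq (hk : D.IsFork k) (hjk : (j : ℕ) + 1 = k) : D.row k = lo j := by
  rw [row_of_isFork hk]
  simp only [pv, lo, Fin.ext_iff]; omega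

theorem nx_eq_lo (hjk : (j : ℕ) + 1 = k) : nx j = lo k := by
  simp only [nx, lo, Fin.ext_iff]; omega

theorem row_of_lt (hjk : (j : ℕ) + 1 = k) : D.row j = lo j :=
  row_of_not_isFork (not_isFork_of_lt (by omega : (j : ℕ) < k))

theorem lo_ne_lo (h : i ≠ j) : lo i ≠ lo j := by
  simp only [lo, ne_eq, Fin.ext_iff] at *; omega

theorem lo_ne_rev_lo (i j : Fin (rk m n)) : lo i ≠ (lo j).rev := by
  have hi := i.2
  have hj := j.2
  unfold rk at hi hj
  simp only [lo, ne_eq, Fin.ext_iff, Fin.val_rev]; omega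

theorem IsFork.not_isLong (hk : D.IsFork k) : ¬ D.IsLong k := fun h => h.not_isFork hk

theorem genMat_e_of_lt (hjk : (j : ℕ) + 1 = k) : D.genMat (.e j) = toK (D.X (lo j) (lo k)) := by
  rw [genMat, chevE_of_not_isLong (not_isLong_of_lt (by omega : (j : ℕ) < k)), nx_eq_lo hjk,
    row_of_lt hjk]

theorem genMat_f_of_lt (hjk : (j : ℕ) + 1 = k) :
    D.genMat (.f j) = (sgn (D.parity (lo j)) : K) • toK (D.X (lo k) (lo j)) := by
  have hL := not_isLong_of_lt (D := D) (by omega : (j : ℕ) < k)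
  rw [genMat, kappa_of_not_isLong hL, one_smul, chevF_of_not_isLong hL, nx_eq_lo hjk,
    row_of_lt hjk, toK_smul]

theorem IsFork.genMat_e (hn : Even n) (hk : D.IsFork k) (hjk : (j : ℕ) + 1 = k) :
    D.genMat (.e k) = toK (D.X (lo j) (lo k).rev) := by
  rw [genMat, chevE_of_not_isLong hk.not_isLong, hk.nx_eq hn, hk.row_eq hjk]

theorem IsFork.genMat_f (hn : Even n) (hk : D.IsFork k) (hjk : (j : ℕ) + 1 = k) :
    D.genMat (.f k) = (sgn (D.parity (lo j)) : K) • toK (D.X (lo k).rev (lo j)) := by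
  rw [genMat, kappa_of_not_isLong hk.not_isLong, one_smul, chevF_of_not_isLong hk.not_isLong,
    hk.nx_eq hn, hk.row_eq hjk, toK_smul]

theorem IsFork.rootParity_eq (hn : Even n) (hk : D.IsFork k) (hjk : (j : ℕ) + 1 = k) :
    D.rootParity k = D.parity (lo j) := by
  rw [rootParity, hk.nx_eq hn, hk.row_eq hjk, D.parity_rev, hk.2.2, add_zero]

theorem IsFork.rootParity_prev (hk : D.IsFork k) (hjk : (j : ℕ) + 1 = k) :
    D.rootParity j = D.parity (lo j) := by
  rw [rootParity, nx_eq_lo hjk, row_of_lt hjk, hk.2.2, add_zero]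

/-- The weight α_{s-1} - α_s = -2ε_s occurs in End(V), so the products have to be computed. -/
theorem IsFork.genMat_e_mul_f (hn : Even n) (hk : D.IsFork k) (hjk : (j : ℕ) + 1 = k) :
    D.genMat (.e j) * D.genMat (.f k) =
      (sgn (D.rootParity j * D.rootParity k) : K) • (D.genMat (.f k) * D.genMat (.e j)) := by
  have hx : ∀ x : ZMod 2, x * x = x := by decide
  rw [hk.rootParity_eq hn hjk, hk.rootParity_prev hjk, hx, genMat_e_of_lt hjk,
    hk.genMat_f hn hjk, mul_smul_comm, smul_mul_assoc, ← map_mul, ← map_mul, D.X_mul_X_rev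
      (lo_ne_lo (by omega)) (lo_ne_rev_lo _ _) hk.2.2 (lo_ne_rev_lo _ _), toK_smul]

theorem IsFork.genMat_e_mul_f' (hn : Even n) (hk : D.IsFork k) (hjk : (j : ℕ) + 1 = k) :
    D.genMat (.e k) * D.genMat (.f j) =
      (sgn (D.rootParity k * D.rootParity j) : K) • (D.genMat (.f j) * D.genMat (.e k)) := by
  have hx : ∀ x : ZMod 2, x * x = x := by decide
  have h := D.X_mul_X_rev (lo_ne_rev_lo j k) (b := (lo k).rev)
    (by rw [Fin.rev_rev]; exact lo_ne_lo (by omega)) (by rw [D.parity_rev]; exact hk.2.2)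
    (by rw [Fin.rev_rev]; exact (lo_ne_rev_lo k k).symm)
  rw [Fin.rev_rev] at h
  rw [hk.rootParity_eq hn hjk, hk.rootParity_prev hjk, hx, genMat_f_of_lt hjk,
    hk.genMat_e hn hjk, mul_smul_comm, smul_mul_assoc, ← map_mul, ← map_mul, h, toK_smul]

theorem IsFork.commute_genMat_e (hn : Even n) (hk : D.IsFork k) (hjk : (j : ℕ) + 1 = k) :
    Commute (D.genMat (.e j)) (D.genMat (.e k)) := by
  rw [genMat_e_of_lt hjk, hk.genMat_e hn hjk]
  exact (D.commute_X_X_rev (lo_ne_lo (by omega)) (lo_ne_rev_lo _ _) (lo_ne_rev_lo _ _)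
    hk.2.2).map _

theorem IsFork.commute_genMat_f (hn : Even n) (hk : D.IsFork k) (hjk : (j : ℕ) + 1 = k) :
    Commute (D.genMat (.f j)) (D.genMat (.f k)) := by
  rw [genMat_f_of_lt hjk, hk.genMat_f hn hjk]
  exact (((D.commute_X_rev_X (lo_ne_lo (by omega)) (lo_ne_rev_lo _ _) (lo_ne_rev_lo _ _)
    hk.2.2).map toK).smul_left _).smul_right _

theorem toK_X (a b : Fin (m + n)) :
    toK (D.X a b) = single a b 1 + single b.rev a.rev (-(D.coef a b : K)) := by
  rw [X_eq, map_sub, toK_single, toK_single, Int.cast_one, sub_eq_add_neg, ← single_neg]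

theorem IsFork.cubic_e (hn : Even n) (hk : D.IsFork k) (hij : (i : ℕ) + 1 = j)
    (hjk : (j : ℕ) + 1 = k) (u v : K) :
    let A := D.genMat (.e i)
    let B := D.genMat (.e j)
    let C := D.genMat (.e k)
    C * (B * A - u • (A * B)) - v • ((B * A - u • (A * B)) * C) =
      B * (C * A - u • (A * C)) - v • ((C * A - u • (A * C)) * B) := by
  rw [genMat_e_of_lt hij, genMat_e_of_lt hjk, hk.genMat_e hn hjk, toK_X, toK_X, toK_X, Fin.rev_rev]
  refine cubic_matrix (lo_ne_lo (by omega)) (lo_ne_rev_lo _ _) (lo_ne_rev_lo _ _)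
    (lo_ne_lo (by omega)) (lo_ne_rev_lo _ _) (lo_ne_rev_lo _ _) (lo_ne_rev_lo _ _)
    (lo_ne_rev_lo _ _) (fun h => lo_ne_lo (by omega) (Fin.rev_injective h))
    (fun h => lo_ne_lo (by omega) (Fin.rev_injective h)) ?_
  rw [coef_rev_right D hk.2.2]

theorem IsFork.cubic_f (hn : Even n) (hk : D.IsFork k) (hij : (i : ℕ) + 1 = j)
    (hjk : (j : ℕ) + 1 = k) (u v : K) :
    let A := D.genMat (.f i)
    let B := D.genMat (.f j)
    let C := D.genMat (.f k)
    C * (B * A - u • (A * B)) - v • ((B * A - u • (A * B)) * C) =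
      B * (C * A - u • (A * C)) - v • ((C * A - u • (A * C)) * B) := by
  rw [genMat_f_of_lt hij, genMat_f_of_lt hjk, hk.genMat_f hn hjk, toK_X, toK_X, toK_X, Fin.rev_rev]
  simp only [smul_add, smul_single]
  -- With the summands exchanged, the f_i have the shape required by `cubic_matrix`, each index
  -- being replaced by its mirror image.
  simp only [add_comm (single (lo j) (lo i) _), add_comm (single (lo k) (lo j) _),
    add_comm (single (lo k).rev (lo j) _)]
  refine cubic_matrix (fun h => lo_ne_lo (by omega) (Fin.rev_injective h))
    (lo_ne_rev_lo _ _).symm (lo_ne_rev_lo _ _).symm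
    (fun h => lo_ne_lo (by omega) (Fin.rev_injective h))
    (lo_ne_rev_lo _ _).symm (lo_ne_rev_lo _ _).symm (lo_ne_rev_lo _ _).symm
    (lo_ne_rev_lo _ _).symm (lo_ne_lo (by omega)) (lo_ne_lo (by omega)) ?_
  rw [coef_rev_left D hk.2.2]

end Fork

theorem genMat_e_superbracket_f_of_ne (hn : Even n) (hN : 2 < m + n) (hij : i ≠ j) :
    D.genMat (.e i) * D.genMat (.f j) -
        (sgn (D.rootParity i * D.rootParity j) : K) • (D.genMat (.f j) * D.genMat (.e i)) = 0 := by
  by_cases h1 : D.IsFork j ∧ (i : ℕ) + 1 = j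
  · exact sub_eq_zero.mpr (h1.1.genMat_e_mul_f hn h1.2)
  by_cases h2 : D.IsFork i ∧ (j : ℕ) + 1 = i
  · exact sub_eq_zero.mpr (h2.1.genMat_e_mul_f' hn h2.2)
  have he := isGraded_eps_genMat_e (D := D) hn i
  have hf := isGraded_eps_genMat_f (D := D) hn j
  refine ((he.mul hf).sub ((add_comm (-D.simpleRoot j) (D.simpleRoot i) ▸ hf.mul he).smul
    _)).eq_zero_of_large ?_
  rw [← sub_eq_add_neg]
  exact large_sub hn hN hij h1 h2

end ParityData

/-! ### The q-Serre relations -/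

namespace ParityData

variable {D : ParityData m n} {i j k : Fin (rk m n)}

variable (D) in
/-- A homogeneous element acts on `V` by an operator whose weight is its degree. -/
def ActsByDegree (a : HomElt m n) : Prop := IsGraded eps (D.freeRep a.val) a.deg

theorem freeRep_br (a b : HomElt m n) :
    D.freeRep (D.br a b).val = D.freeRep a.val * D.freeRep b.val -
      ((sgn (a.par * b.par) : K) * q ^ D.form a.deg b.deg) •
        (D.freeRep b.val * D.freeRep a.val) := by
  simp only [br, map_sub, map_mul, map_smul]

theorem ActsByDegree.br {a b : HomElt m n} (ha : D.ActsByDegree a) (hb : D.ActsByDegree b) :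
    D.ActsByDegree (D.br a b) := by
  unfold ActsByDegree
  rw [freeRep_br]
  exact (ha.mul hb).sub ((add_comm b.deg a.deg ▸ hb.mul ha).smul _)

theorem ActsByDegree.br_iterate {a b : HomElt m n} (ha : D.ActsByDegree a)
    (hb : D.ActsByDegree b) (k : ℕ) : D.ActsByDegree ((D.br a)^[k] b) := by
  induction k with
  | zero => exact hb
  | succ k ih => rw [Function.iterate_succ_apply']; exact ha.br ih

theorem deg_br_iterate (a b : HomElt m n) (k : ℕ) :
    ((D.br a)^[k] b).deg = (k : ℤ) • a.deg + b.deg := by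
  induction k with
  | zero => simp
  | succ k ih =>
    rw [Function.iterate_succ_apply']
    change a.deg + _ = _
    rw [ih]
    push_cast
    rw [add_smul, one_smul]
    abel

theorem ActsByDegree.freeRep_eq_zero {a : HomElt m n} (ha : D.ActsByDegree a) {σ : ℤ}
    (hσ : σ = 1 ∨ σ = -1) {β : Wt m n} (h : a.deg = σ • β) (hβ : Large β) :
    D.freeRep a.val = 0 := by
  refine IsGraded.eq_zero_of_large ha ?_
  rw [h]
  rcases hσ with rfl | rfl
  · rwa [one_smul]
  · rw [neg_one_smul]; exact hβ.neg

/-- The `q`-Serre relations hold on `V` for a family of operators of weights `σ α_i`, `σ = ±1`,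
as soon as the relations between the end nodes of a fork do. -/
theorem freeRep_serre (hn : Even n) (hN : 2 < m + n) {x : Fin (rk m n) → HomElt m n} {σ : ℤ}
    (hσ : σ = 1 ∨ σ = -1) (hdeg : ∀ i, (x i).deg = σ • D.simpleRoot i)
    (hpar : ∀ i, (x i).par = D.rootParity i) (hx : ∀ i, D.ActsByDegree (x i))
    (hcomm : ∀ j k : Fin (rk m n), D.IsFork k → (j : ℕ) + 1 = k →
      Commute (D.freeRep (x j).val) (D.freeRep (x k).val))
    (hcubic : ∀ i j k : Fin (rk m n), D.IsFork k → (i : ℕ) + 1 = j → (j : ℕ) + 1 = k →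
      ∀ u v : K,
      let A := D.freeRep (x i).val
      let B := D.freeRep (x j).val
      let C := D.freeRep (x k).val
      C * (B * A - u • (A * B)) - v • ((B * A - u • (A * B)) * C) =
        B * (C * A - u • (A * C)) - v • ((C * A - u • (A * C)) * B))
    {z : Free m n} (hz : D.SerreElt x z) : D.freeRep z = 0 := by
  have hform : ∀ i j, D.form (x i).deg (x j).deg = D.cartan i j := fun i j => by
    rw [hdeg, hdeg, form_smul_left, form_smul_right, cartan]
    rcases hσ with rfl | rfl <;> simp
  have hdbr : ∀ a b, (D.br a b).deg = a.deg + b.deg := fun _ _ => rfl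
  -- Orthogonality of the two ends forces v_{s-1} to be even like v_s, so the q-superbracket is an
  -- ordinary commutator.
  have hfork : ∀ {j k : Fin (rk m n)}, D.IsFork k → (j : ℕ) + 1 = k → D.cartan j k = 0 →
      D.rootParity j * D.rootParity k = 0 := fun {j k} hk hjk h => by
    have hlt : (j : ℕ) < k := by omega
    rw [hk.rootParity_eq hn hjk, hk.rootParity_prev hjk]
    rw [cartan_of_next (not_isLong_of_lt hlt) (not_isFork_of_lt hlt) hjk.symm,
      hk.simpleRoot_prev hn hN hjk, hk.simpleRoot_self hn hN, hk.2.2] at h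
    rcases zmod_two_cases (D.parity (lo j)) with h0 | h0
    · rw [h0]; rfl
    · rw [h0] at h; exact absurd h (by decide)
  cases hz with
  | orthogonal i j hij h =>
    by_cases h1 : D.IsFork j ∧ (i : ℕ) + 1 = j
    · rw [freeRep_br, hform, h, hpar, hpar, hfork h1.1 h1.2 h, (hcomm i j h1.1 h1.2).eq]
      simp [sgn]
    by_cases h2 : D.IsFork i ∧ (j : ℕ) + 1 = i
    · rw [freeRep_br, hform, h, hpar, hpar, mul_comm (D.rootParity i),
        hfork h2.1 h2.2 (D.cartan_comm i j ▸ h), (hcomm j i h2.1 h2.2).eq]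
      simp [sgn]
    exact ((hx i).br (hx j)).freeRep_eq_zero hσ (by rw [hdbr, hdeg, hdeg, smul_add])
      (large_add hn hN hij h1 h2 h)
  | isotropic i h =>
    rw [pow_two, map_mul]
    refine IsGraded.eq_zero_of_large ((hx i).mul (hx i)) ?_
    have := large_two_smul hn hN h
    rw [hdeg]
    rcases hσ with rfl | rfl
    · rwa [one_smul]
    · rw [neg_one_smul, ← neg_add]; exact this.neg
  | standard i j hij hi h =>
    exact ((hx i).br_iterate (hx j) _).freeRep_eq_zero hσ
      (by rw [deg_br_iterate, hdeg, hdeg, smul_add, smul_comm]) (large_standard hn hN hij hi h)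
  | quartic i j k hij hjk hj hik h0 h =>
    exact ((((hx i).br (hx j)).br (hx k)).br (hx j)).freeRep_eq_zero hσ
      (by simp only [hdbr, hdeg, smul_add]) (large_quartic hn hN hij hjk hj h0 h)
  | sextic i j k hij hjk hk hm pi pj pk =>
    exact ((((hx i).br (hx j)).br (((hx i).br (hx j)).br (hx k))).br (hx j)).freeRep_eq_zero hσ
      (by simp only [hdbr, hdeg, smul_add]) (large_sextic hn hN hij hjk pk)
  | septic l i j k hli hij hjk hk hm pi pj pk =>
    exact (((((((hx l).br (hx i)).br (hx j)).br (hx k)).br (hx j)).br (hx i)).br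
      (hx j)).freeRep_eq_zero hσ
      (by simp only [hdbr, hdeg, smul_add]) (large_septic hn hN hli hij hjk pk)
  | cubic i j k hij hjk hk hm pj pk =>
    have hF : D.IsFork k := ⟨hm, hk, pk⟩
    -- The two ends have the same parity and the same pairing with α_{s-2}, so both sides of the
    -- cubic relation carry the same scalars `u` and `v`.
    have hpj : D.rootParity k = D.rootParity j := by
      rw [hF.rootParity_eq hn hjk, hF.rootParity_prev hjk]
    have hc : D.cartan k i = D.cartan j i := by
      have hlt : (j : ℕ) < k := by omega
      rw [hF.cartan_eq hn hjk,
        cartan_of_next (not_isLong_of_lt hlt) (not_isFork_of_lt hlt) hjk.symm,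
        simpleRoot_of_next_lt hn hN (by omega : (i : ℕ) + 1 < k)]
      simp
    have hpbr : ∀ a b, (D.br a b).par = a.par + b.par := fun _ _ => rfl
    rw [map_sub, sub_eq_zero]
    simp only [freeRep_br, hdbr, hpbr, hpar, form_add_right, hform, hpj, hc, D.cartan_comm k j]
    exact hcubic i j k hF hij hjk _ _

theorem freeRep_serre_e (hn : Even n) (hN : 2 < m + n) {z : Free m n}
    (hz : D.SerreElt D.eElt z) : D.freeRep z = 0 := by
  refine freeRep_serre hn hN (Or.inl rfl) (fun i => (one_smul _ _).symm) (fun i => rfl)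
    (fun i => ?_) (fun j k hk hjk => ?_) (fun i j k hk hij hjk u v => ?_) hz
  · simpa only [ActsByDegree, eElt, freeRep_gen] using isGraded_eps_genMat_e hn i
  · simpa only [eElt, freeRep_gen] using hk.commute_genMat_e hn hjk
  · simpa only [eElt, freeRep_gen] using hk.cubic_e hn hij hjk u v

theorem freeRep_serre_f (hn : Even n) (hN : 2 < m + n) {z : Free m n}
    (hz : D.SerreElt D.fElt z) : D.freeRep z = 0 := by
  refine freeRep_serre hn hN (Or.inr rfl) (fun i => (neg_one_smul _ _).symm) (fun i => rfl)
    (fun i => ?_) (fun j k hk hjk => ?_) (fun i j k hk hij hjk u v => ?_) hz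
  · simpa only [ActsByDegree, fElt, freeRep_gen] using isGraded_eps_genMat_f hn i
  · simpa only [fElt, freeRep_gen] using hk.commute_genMat_f hn hjk
  · simpa only [fElt, freeRep_gen] using hk.cubic_f hn hij hjk u v

/-! ### Descent to the quotient, parity and uniqueness -/

theorem genMat_k_comm (i j : Fin (rk m n)) :
    D.genMat (.k i) * D.genMat (.k j) = D.genMat (.k j) * D.genMat (.k i) := by
  rw [genMat, genMat, diagonal_mul_diagonal, diagonal_mul_diagonal]
  congr 1
  funext r
  exact mul_comm _ _

theorem freeRep_rel (hn : Even n) (hN : 2 < m + n) {x y : Free m n} (h : D.Rel x y) :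
    D.freeRep x = D.freeRep y := by
  cases h with
  | k_comm i j => simpa only [map_mul, freeRep_gen] using genMat_k_comm i j
  | k_kInv i => simpa only [map_mul, map_one, freeRep_gen] using genMat_k_mul_genMat_kInv i
  | kInv_k i => simpa only [map_mul, map_one, freeRep_gen] using genMat_kInv_mul_genMat_k i
  | k_e i j =>
    simp only [map_mul, map_smul, freeRep_gen]
    exact genMat_k_conj (isGraded_eps_genMat_e hn j) i
  | k_f i j =>
    simp only [map_mul, map_smul, freeRep_gen]
    rw [cartan, ← form_neg_right]
    exact genMat_k_conj (isGraded_eps_genMat_f hn j) i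
  | e_f i j =>
    simp only [map_sub, map_mul, map_smul, freeRep_gen]
    split_ifs with hij
    · subst hij
      rw [genMat_e_superbracket_f_self hn hN]
      simp only [map_sub, map_pow, map_smul, freeRep_gen]
    · rw [genMat_e_superbracket_f_of_ne hn hN hij, map_zero]
  | serre_e _ hz => rw [freeRep_serre_e hn hN hz, map_zero]
  | serre_f _ hz => rw [freeRep_serre_f hn hN hz, map_zero]

variable (D) in
/-- The representation of `U_q(osp(V))` on `V` by matrices. -/
def matRep (hn : Even n) (hN : 2 < m + n) : D.Uq →ₐ[K] Matrix (Fin (m + n)) (Fin (m + n)) K :=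
  RingQuot.liftAlgHom K ⟨D.freeRep, fun _ _ h => freeRep_rel hn hN h⟩

theorem matRep_toUq (hn : Even n) (hN : 2 < m + n) (g : Gen m n) :
    D.matRep hn hN (D.toUq g) = D.genMat g := by
  rw [matRep, toUq, RingQuot.liftAlgHom_mkAlgHom_apply, freeRep_gen]

theorem isGraded_parity_matRep (hn : Even n) (hN : 2 < m + n) {p : ZMod 2} {x : D.Uq}
    (hx : x ∈ D.UqGraded p) : IsGraded D.parity (D.matRep hn hN x) p := by
  induction hx using Submodule.span_induction with
  | mem x hx =>
    obtain ⟨l, rfl, rfl⟩ := hx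
    induction l with
    | nil =>
      simp only [List.map_nil, List.prod_nil, List.sum_nil, map_one]
      exact IsGraded.one
    | cons g l ih =>
      simp only [List.map_cons, List.prod_cons, List.sum_cons, map_mul, matRep_toUq]
      exact (isGraded_parity_genMat g).mul ih
  | zero => rw [map_zero]; exact fun t r h => absurd rfl h
  | add x y _ _ hx hy => rw [map_add]; exact hx.add hy
  | smul c x _ hx => rw [map_smul]; exact hx.smul c

theorem mulVec_mem_VGraded {A : Matrix (Fin (m + n)) (Fin (m + n)) K} {a b : ZMod 2}
    (hA : IsGraded D.parity A a) {v : Fin (m + n) → K} (hv : v ∈ D.VGraded b) :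
    A *ᵥ v ∈ D.VGraded (a + b) := by
  induction hv using Submodule.span_induction with
  | mem v hv =>
    obtain ⟨i, rfl, rfl⟩ := hv
    -- The image of a basis vector is a column of `A`, supported on the rows whose parity is shifted
    -- by `a`.
    rw [Matrix.mulVec_single_one, pi_eq_sum_univ' (A.col i)]
    refine Submodule.sum_mem _ fun t _ => ?_
    by_cases h : A t i = 0
    · rw [Matrix.col_apply, h, zero_smul]; exact Submodule.zero_mem _
    · refine Submodule.smul_mem _ _ (Submodule.subset_span ⟨t, ?_, ?_⟩)
      · rw [← hA t i h, sub_add_cancel]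
      · funext j
        simp [Pi.single_apply, eq_comm]
  | zero => rw [Matrix.mulVec_zero]; exact Submodule.zero_mem _
  | add v w _ _ hv hw => rw [Matrix.mulVec_add]; exact Submodule.add_mem _ hv hw
  | smul c v _ hv => rw [Matrix.mulVec_smul]; exact Submodule.smul_mem _ _ hv

/-- An algebra homomorphism from `U_q(osp(V))` is determined by its values on the generators. -/
theorem algHom_ext {A : Type*} [Ring A] [Algebra K A] {φ ψ : D.Uq →ₐ[K] A}
    (h : ∀ g, φ (D.toUq g) = ψ (D.toUq g)) : φ = ψ :=
  RingQuot.ringQuot_ext' K _ _ (FreeAlgebra.hom_ext (funext h))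

end ParityData

end QuantumOsp

end

open QuantumOsp in
theorem proposition3p1 (m n : ℕ) (hn : Even n) (hN : 2 < m + n) (D : ParityData m n) :
    ∃ ρ : D.Uq →ₐ[K] Module.End K (Fin (m + n) → K),
      ((∀ i, ρ (D.toUq (.e i)) = matOp (D.chevE i)) ∧
        (∀ i, ρ (D.toUq (.f i)) = D.kappa i • matOp (D.chevF i)) ∧
        (∀ i, ρ (D.toUq (.k i)) = qPowHalf (D.chevH i)) ∧
        (∀ i, ρ (D.toUq (.kInv i)) = qPowHalf (-D.chevH i))) ∧
      (∀ (a b : ZMod 2), ∀ x ∈ D.UqGraded a, ∀ v ∈ D.VGraded b, ρ x v ∈ D.VGraded (a + b)) ∧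
      ∀ ρ' : D.Uq →ₐ[K] Module.End K (Fin (m + n) → K),
        (∀ g, ρ' (D.toUq g) = ρ (D.toUq g)) → ρ' = ρ := by
  have hρ : ∀ x, ((Matrix.toLinAlgEquiv' : _ ≃ₐ[K] _).toAlgHom.comp (D.matRep hn hN)) x =
      Matrix.toLin' (D.matRep hn hN x) := fun x => rfl
  refine ⟨(Matrix.toLinAlgEquiv' : _ ≃ₐ[K] _).toAlgHom.comp (D.matRep hn hN),
    ⟨fun i => ?_, fun i => ?_, fun i => ?_, fun i => ?_⟩, fun a b x hx v hv => ?_,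
    fun ρ' h => ParityData.algHom_ext h⟩
  · rw [hρ, ParityData.matRep_toUq]; rfl
  · rw [hρ, ParityData.matRep_toUq, ParityData.genMat, map_smul]; rfl
  · rw [hρ, ParityData.matRep_toUq]; rfl
  · rw [hρ, ParityData.matRep_toUq]; rfl
  · rw [hρ, Matrix.toLin'_apply]
    exact ParityData.mulVec_mem_VGraded (ParityData.isGraded_parity_matRep hn hN hx) hv
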